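/- **Setting.** Let $(\Omega,\mathcal F,(\mathcal F_t),\mathbb P)$ be a filtered probability space in discrete or continuous time with $\mathcal F=\mathcal F_T$, and fix a time $t\le T$. Let $p,q\in[1,\infty]$ with $\frac1p+\frac1q=1$. Write $L^p_t(D)$ for the (classes of) $\mathcal F_t$-measurable, $p$-integrable random vectors with values a.s. in the (possibly random) set $D$, $L^p_d=L^p_T(\mathbb R^d)$, $L^q(D)=L^q_T(D)$; $L^p_d$ carries the norm topology if $p<\infty$ and the weak* topology $\sigma(L^\infty_d,L^1_d)$ if $p=\infty$. Let $1\le m\le d$, $M=\mathbb R^m\times\{0\}^{d-m}$, $M_+=M\cap\mathbb R^d_+$, $M_t=L^p_t(M)$, $M_{t,+}=L^p_t(M_+)$, $M_{t,-}=-M_{t,+}$. For $C\subseteq\mathbb R^d$ let $C^+=\{v\in\mathbb R^d: v^{\mathsf T}u\ge0\ \forall u\in C\}$, and let $M^\perp$ be the orthogonal space of $M$. Let $R_t$ be a conditional risk measure, i.e. a map from $L^p_d$ to the subsets of $M_t$ with $R_t(X)=R_t(X)+M_{t,+}$ for all $X$, such that (i) $Y-X\ge 0$ a.s. implies $R_t(X)\subseteq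 R_t(Y)$; (ii) $R_t(X+c)=R_t(X)-c$ for all $c\in M_t$; (iii) $R_t(0)$ is nonempty, closed, $\mathcal F_t$-decomposable, and $R_t(0)=L^p_t(\tilde R_t(0))$ for an $\mathcal F_t$-measurable random closed set $\tilde R_t(0)$ with $\mathbb P(\tilde R_t(0)=M)=0$. Assume that $R_t$ is normalized ($R_t(X)=R_t(X)+R_t(0)$ for all $X$); convex upper continuous ($\{X: R_t(X)\cap D\ne\emptyset\}$ is closed for every $D\subseteq M_t$ with $D=\operatorname{cl}\operatorname{co}(D+M_{t,-})$); and conditionally coherent, i.e. conditionally convex ($\lambda R_t(X)+(1-\lambda)R_t(Y)\subseteq R_t(\lambda X+(1-\lambda)Y)$ for all $X,Y$ and $\lambda\in L^\infty_t([0,1])$) and conditionally positive homogeneous ($\lambda R_t(X)\subseteq R_t(\lambda X)$ for all $X$ and $\lambda\in L^\infty_t((0,\infty))$; equality follows when $1/\lambda$ is bounded too). Let $A_t=\{X\in L^p_d: 0\in R_t(X)\}$ and $A_t^+=\{v\in L^q_d:\mathbb E[v^{\mathsf T}Z]\ge0\ \forall Z\in A_t\}$. For $w\in L^q_t(\tilde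 R_t(0)^+\setminus M^\perp)$ and $X\in L^p_d$ put $$\rho_t^w(X)=\operatorname{ess\,inf}\{w^{\mathsf T}u: u\in R_t(X)\},$$ and assume that $\rho_t^w(X)$ is integrable for all such $w$ and $X$. **Dual variables.** Let $\mathcal M^d$ be the set of $d$-tuples $\mathbb Q=(\mathbb Q_1,\dots,\mathbb Q_d)$ of probability measures absolutely continuous with respect to $\mathbb P$. Let $\xi_{t,T}(\mathbb Q)_i=\frac{\mathbb E[d\mathbb Q_i/d\mathbb P\mid\mathcal F_T]}{\mathbb E[d\mathbb Q_i/d\mathbb P\mid\mathcal F_t]}$ where the denominator is positive, and $1$ elsewhere. Put $w_t^T(\mathbb Q,w)=\operatorname{diag}(w)\,\xi_{t,T}(\mathbb Q)$ and $\mathbb E^{\mathbb Q}[X\mid\mathcal F_t]_i=\mathbb E[\xi_{t,T}(\mathbb Q)_iX_i\mid\mathcal F_t]$. Here conditional expectations are taken in the extended sense $\mathbb E[f^+\mid\mathcal F_t]-\mathbb E[f^-\mid\mathcal F_t]$; in the formula below both terms are finite wherever the weight $(w+m_\perp)_i$ is nonzero, and a component of weight zero contributes zero. Let $\mathcal W_t(w)$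 be the set of pairs $(\mathbb Q,m_\perp)\in\mathcal M^d\times L^q_t(M^\perp)$ with $w+m_\perp\in L^q_t(M_+^+\setminus M^\perp)$ and $w_t^T(\mathbb Q,w+m_\perp)\in L^q(\mathbb R^d_+)$, and let $$\mathcal W_t^R(w)=\{(\mathbb Q,m_\perp)\in\mathcal W_t(w): w_t^T(\mathbb Q,w+m_\perp)\in A_t^+\}.$$ **Claim.** For every $w\in L^q_t(\tilde R_t(0)^+\setminus M^\perp)$ and every $X\in L^p_d$, $$\rho_t^w(X)=\operatorname*{ess\,sup}_{(\mathbb Q,m_\perp)\in\mathcal W_t^R(w)}(w+m_\perp)^{\mathsf T}\,\mathbb E^{\mathbb Q}[-X\mid\mathcal F_t]\qquad\mathbb P\text{-a.s.}$$ -/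

import Mathlib

open MeasureTheory Set
open scoped ENNReal Pointwise

namespace SetRisk

noncomputable section

variable {Ω : Type*} {mΩ : MeasurableSpace Ω}

/-! ### Essential suprema and infima of families of random variables -/

/-- `Y` is the essential supremum of the (arbitrary, possibly uncountable) family `f` in
`L⁰(Ω, m, μ; [-∞, ∞])`. -/
structure IsFamEssSup {κ : Type*} (m : MeasurableSpace Ω) (μ : Measure[mΩ] Ω)
    (f : κ → Ω → EReal) (Y : Ω → EReal) : Prop where
  measurable : Measurable[m] Y
  upper : ∀ i, f i ≤ᵐ[μ] Y
  least : ∀ Z : Ω → EReal, Measurable[m] Z → (∀ i, f i ≤ᵐ[μ] Z) → Y ≤ᵐ[μ] Z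

/-- `Y` is the essential infimum of the family `f` in `L⁰(Ω, m, μ; [-∞, ∞])`. -/
structure IsFamEssInf {κ : Type*} (m : MeasurableSpace Ω) (μ : Measure[mΩ] Ω)
    (f : κ → Ω → EReal) (Y : Ω → EReal) : Prop where
  measurable : Measurable[m] Y
  lower : ∀ i, Y ≤ᵐ[μ] f i
  greatest : ∀ Z : Ω → EReal, Measurable[m] Z → (∀ i, Z ≤ᵐ[μ] f i) → Z ≤ᵐ[μ] Y

/-- An order embedding of `[-∞, ∞]` into `[0, 1]`. -/
def squash (x : EReal) : ℝ≥0∞ := ((EReal.exp x)⁻¹ + 1)⁻¹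

theorem squash_le_one (x : EReal) : squash x ≤ 1 := by
  unfold squash
  rw [ENNReal.inv_le_one]
  exact le_add_self

theorem squash_le_iff {x y : EReal} : squash x ≤ squash y ↔ x ≤ y := by
  unfold squash
  rw [ENNReal.inv_le_inv, ENNReal.add_le_add_iff_right (by simp), ENNReal.inv_le_inv]
  exact EReal.exp_strictMono.le_iff_le

theorem measurable_squash : Measurable squash :=
  ((EReal.measurable_exp.inv).add_const 1).inv

theorem exists_isFamEssSup {κ : Type*} {m : MeasurableSpace Ω} (hm : m ≤ mΩ) (μ : Measure[mΩ] Ω)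
    [IsFiniteMeasure μ] (f : κ → Ω → EReal) : ∃ Y, IsFamEssSup m μ f Y := by
  classical
  let S : Set (Ω → EReal) := {Z | Measurable[m] Z ∧ ∀ i, f i ≤ᵐ[μ] Z}
  let I : (Ω → EReal) → ℝ≥0∞ := fun Z => ∫⁻ ω, squash (Z ω) ∂μ
  have hne : (I '' S).Nonempty :=
    ⟨_, ⟨fun _ => ⊤, ⟨measurable_const, fun i => Filter.Eventually.of_forall fun _ => le_top⟩, rfl⟩⟩
  obtain ⟨u, -, hu, huS⟩ := exists_seq_tendsto_sInf hne (OrderBot.bddBelow _)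
  choose Z hZ hZu using huS
  have hY : (fun ω => ⨅ n, Z n ω) ∈ S := by
    refine ⟨Measurable.iInf fun n => (hZ n).1, fun i => ?_⟩
    have : ∀ᵐ ω ∂μ, ∀ n, f i ω ≤ Z n ω := ae_all_iff.2 fun n => (hZ n).2 i
    filter_upwards [this] with ω h using le_iInf h
  have hle : ∀ W ∈ S, I (fun ω => ⨅ n, Z n ω) ≤ I W := by
    intro W hW
    have h1 : I (fun ω => ⨅ n, Z n ω) ≤ sInf (I '' S) := by
      refine ge_of_tendsto' hu fun n => ?_
      rw [← hZu n]
      exact lintegral_mono fun ω => squash_le_iff.2 (iInf_le _ n)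
    exact h1.trans (sInf_le ⟨W, hW, rfl⟩)
  refine ⟨_, hY.1, hY.2, fun W hW hWu => ?_⟩
  set Y : Ω → EReal := fun ω => ⨅ n, Z n ω with hYdef
  have hmin : (fun ω => min (Y ω) (W ω)) ∈ S := by
    refine ⟨hY.1.min hW, fun i => ?_⟩
    filter_upwards [hY.2 i, hWu i] with ω h1 h2 using le_min h1 h2
  have hfin : I (fun ω => min (Y ω) (W ω)) ≠ ∞ := by
    refine ne_top_of_le_ne_top (measure_ne_top μ univ) ?_
    calc I (fun ω => min (Y ω) (W ω)) ≤ ∫⁻ _, 1 ∂μ := lintegral_mono fun ω => squash_le_one _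
      _ = μ univ := by simp
  have hae := ae_eq_of_ae_le_of_lintegral_le (μ := μ)
    (f := fun ω => squash (min (Y ω) (W ω))) (g := fun ω => squash (Y ω))
    (Filter.Eventually.of_forall fun ω => squash_le_iff.2 (min_le_left _ _)) hfin
    (by exact (measurable_squash.comp (hY.1.mono hm le_rfl)).aemeasurable) (hle _ hmin)
  filter_upwards [hae] with ω hω
  exact (squash_le_iff.1 hω.ge).trans (min_le_right _ _)

theorem exists_isFamEssInf {κ : Type*} {m : MeasurableSpace Ω} (hm : m ≤ mΩ) (μ : Measure[mΩ] Ω)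
    [IsFiniteMeasure μ] (f : κ → Ω → EReal) : ∃ Y, IsFamEssInf m μ f Y := by
  obtain ⟨Y, h1, h2, h3⟩ := exists_isFamEssSup hm μ (fun i ω => - f i ω)
  refine ⟨fun ω => - Y ω, continuous_neg.measurable.comp h1, fun i => ?_, fun Z hZ h => ?_⟩
  · filter_upwards [h2 i] with ω hω using EReal.neg_le_of_neg_le hω
  · have := h3 (fun ω => - Z ω) (continuous_neg.measurable.comp hZ) fun i => by
      filter_upwards [h i] with ω hω using EReal.neg_le_neg_iff.2 hω
    filter_upwards [this] with ω hω using EReal.le_neg_of_le_neg hω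

/-- The essential supremum (a version of it) of a family of random variables, in
`L⁰(Ω, m, μ; [-∞, ∞])`. -/
def famEssSup {κ : Type*} {m : MeasurableSpace Ω} (hm : m ≤ mΩ) (μ : Measure[mΩ] Ω)
    [IsFiniteMeasure μ] (f : κ → Ω → EReal) : Ω → EReal :=
  (exists_isFamEssSup hm μ f).choose

/-- The essential infimum (a version of it) of a family of random variables, in
`L⁰(Ω, m, μ; [-∞, ∞])`. -/
def famEssInf {κ : Type*} {m : MeasurableSpace Ω} (hm : m ≤ mΩ) (μ : Measure[mΩ] Ω)
    [IsFiniteMeasure μ] (f : κ → Ω → EReal) : Ω → EReal :=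
  (exists_isFamEssInf hm μ f).choose

theorem isFamEssSup_famEssSup {κ : Type*} {m : MeasurableSpace Ω} (hm : m ≤ mΩ) (μ : Measure[mΩ] Ω)
    [IsFiniteMeasure μ] (f : κ → Ω → EReal) : IsFamEssSup m μ f (famEssSup hm μ f) :=
  (exists_isFamEssSup hm μ f).choose_spec

theorem isFamEssInf_famEssInf {κ : Type*} {m : MeasurableSpace Ω} (hm : m ≤ mΩ) (μ : Measure[mΩ] Ω)
    [IsFiniteMeasure μ] (f : κ → Ω → EReal) : IsFamEssInf m μ f (famEssInf hm μ f) :=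
  (exists_isFamEssInf hm μ f).choose_spec

/-! ### Spaces of random vectors -/

/-- `Lᵖ(Ω, m, μ; D)` for a (random) set `D`: the classes in `Lᵖ(Ω, mΩ, μ; E)` that have an
`m`-measurable representative and take their values in `D` almost surely. -/
def LpIn {E : Type*} [NormedAddCommGroup E] (m : MeasurableSpace Ω) (p : ℝ≥0∞) (μ : Measure[mΩ] Ω)
    (D : Ω → Set E) : Set (Lp E p μ) :=
  {X | AEStronglyMeasurable[m] X μ ∧ ∀ᵐ ω ∂μ, X ω ∈ D ω}

/-- The topology used on `Lᵖ(Ω; ℝᵈ)`: the norm topology for `p < ∞`, and the weak* topology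
`σ(L^∞, L¹)` for `p = ∞`. -/
@[reducible]
def lpTopology {d : ℕ} (p : ℝ≥0∞) [Fact (1 ≤ p)] (μ : Measure[mΩ] Ω) :
    TopologicalSpace (Lp (Fin d → ℝ) p μ) :=
  open Classical in
  if p = ∞ then
    TopologicalSpace.induced
      (fun (X : Lp (Fin d → ℝ) p μ) (Y : Lp (Fin d → ℝ) 1 μ) => ∫ ω, Y ω ⬝ᵥ X ω ∂μ)
      Pi.topologicalSpace
  else inferInstance

/-- The eligible space `ℝᵐ × {0}^{d-m}`: only the first `m` coordinates may be nonzero. -/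
def eligibleSpace (d m : ℕ) : Submodule ℝ (Fin d → ℝ) where
  carrier := {v | ∀ i : Fin d, m ≤ (i : ℕ) → v i = 0}
  add_mem' := fun {a b} ha hb i hi => by simp [ha i hi, hb i hi]
  zero_mem' := fun _ _ => rfl
  smul_mem' := fun c a ha i hi => by simp [ha i hi]

/-- The orthogonal space `M^⊥` in `ℝᵈ`. -/
def perp {d : ℕ} (M : Submodule ℝ (Fin d → ℝ)) : Set (Fin d → ℝ) :=
  {v | ∀ u ∈ M, v ⬝ᵥ u = 0}

/-- The positive dual cone `C⁺` of a subset `C` of `ℝᵈ`. -/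
def dualCone {d : ℕ} (C : Set (Fin d → ℝ)) : Set (Fin d → ℝ) :=
  {v | ∀ u ∈ C, 0 ≤ v ⬝ᵥ u}

/-- `M_+ = M ∩ ℝᵈ_+`. -/
def posPart {d : ℕ} (M : Submodule ℝ (Fin d → ℝ)) : Set (Fin d → ℝ) := {v | v ∈ M ∧ 0 ≤ v}

section Spaces

variable {d : ℕ} (m : MeasurableSpace Ω) (p : ℝ≥0∞) (μ : Measure[mΩ] Ω)
  (M : Submodule ℝ (Fin d → ℝ))

/-- `M_t = Lᵖ_t(M)`. -/
def eligible : Set (Lp (Fin d → ℝ) p μ) := LpIn m p μ fun _ => (M : Set (Fin d → ℝ))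

/-- `M_{t,+} = Lᵖ_t(M_+)`. -/
def eligiblePos : Set (Lp (Fin d → ℝ) p μ) := LpIn m p μ fun _ => posPart M

/-- `M_{t,-} = - M_{t,+}`. -/
def eligibleNeg : Set (Lp (Fin d → ℝ) p μ) := - eligiblePos m p μ M

end Spaces

/-! ### Set-valued conditional risk measures -/

/-- `S` is an `m`-measurable random closed set in `ℝᵈ`. -/
structure IsRandomClosedSet {d : ℕ} (m : MeasurableSpace Ω) (S : Ω → Set (Fin d → ℝ)) : Prop where
  closed : ∀ ω, IsClosed (S ω)
  measurable : ∀ U : Set (Fin d → ℝ), IsOpen U → MeasurableSet[m] {ω | (S ω ∩ U).Nonempty}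

section RiskMeasure

variable {d : ℕ} (m : MeasurableSpace Ω) (p : ℝ≥0∞) [Fact (1 ≤ p)] (μ : Measure[mΩ] Ω)
  (M : Submodule ℝ (Fin d → ℝ))
  (R : Lp (Fin d → ℝ) p μ → Set (Lp (Fin d → ℝ) p μ))

/-- `S` is the random set `R̃_t(0)`: an `m`-measurable random closed set with
`R_t(0) = Lᵖ_t(S)`. -/
def IsZeroSet (S : Ω → Set (Fin d → ℝ)) : Prop :=
  IsRandomClosedSet m S ∧ R 0 = LpIn m p μ S

/-- `C` is decomposable with respect to `m`. -/
def IsDecomposable (C : Set (Lp (Fin d → ℝ) p μ)) : Prop :=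
  ∀ D : Set Ω, MeasurableSet[m] D → ∀ X ∈ C, ∀ Y ∈ C, ∀ Z : Lp (Fin d → ℝ) p μ,
    (∀ᵐ ω ∂μ, (ω ∈ D → Z ω = X ω) ∧ (ω ∉ D → Z ω = Y ω)) → Z ∈ C

/-- `R` is a conditional risk measure `Lᵖ_d → 𝒫(M_t; M_{t,+})` for the `σ`-algebra `m` of the
information at time `t`. -/
structure IsConditionalRiskMeasure : Prop where
  subset_eligible : ∀ X, R X ⊆ eligible m p μ M
  upper : ∀ X, R X = R X + eligiblePos m p μ M
  monotone : ∀ X Y, (∀ᵐ ω ∂μ, 0 ≤ (Y - X) ω) → R X ⊆ R Y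
  translative : ∀ X, ∀ c ∈ eligible m p μ M, R (X + c) = (fun u => u - c) '' R X
  zero_nonempty : (R 0).Nonempty
  zero_closed : @IsClosed _ (lpTopology p μ) (R 0)
  zero_decomposable : IsDecomposable m p μ (R 0)
  zero_finite : ∃ S, IsZeroSet m p μ R S ∧ ∀ᵐ ω ∂μ, S ω ≠ (M : Set (Fin d → ℝ))

/-- `R` is normalized. -/
def IsNormalized : Prop := ∀ X, R X = R X + R 0

/-- `R` is conditionally convex. -/
def IsCondConvex [IsFiniteMeasure μ] : Prop :=
  ∀ X Y, ∀ l ∈ LpIn (E := ℝ) m ∞ μ (fun _ => Icc 0 1),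
    (fun u => l • u) '' R X + (fun u => (Lp.const ∞ μ (1 : ℝ) - l) • u) '' R Y ⊆
      R (l • X + (Lp.const ∞ μ (1 : ℝ) - l) • Y)

/-- `R` is conditionally positive homogeneous. The inclusion for all `l ∈ L^∞_t(ℝ_{++})` says
that the acceptance set is a conditional cone, and it yields equality whenever `1 / l` is bounded
too. Equality cannot be asked for every `l`: at `X = 0` it would put `l⁻¹ • u` into `Lᵖ` for every
`u ∈ R 0` and every such `l`, which fails unless `m` is finite up to null sets. -/
def IsCondPosHomogeneous : Prop :=
  ∀ X, ∀ l ∈ LpIn (E := ℝ) m ∞ μ (fun _ => Ioi 0), (fun u => l • u) '' R X ⊆ R (l • X)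

/-- `R` is conditionally coherent. -/
def IsCondCoherent [IsFiniteMeasure μ] : Prop := IsCondConvex m p μ R ∧ IsCondPosHomogeneous m p μ R

/-- `R` is convex upper continuous: `{X | R X ∩ D ≠ ∅}` is closed for every closed
`D ∈ 𝒢(M_t; M_{t,-})`. -/
def IsConvexUpperContinuous : Prop :=
  ∀ D : Set (Lp (Fin d → ℝ) p μ), D ⊆ eligible m p μ M →
    D = @closure _ (lpTopology p μ) (convexHull ℝ (D + eligibleNeg m p μ M)) →
    @IsClosed _ (lpTopology p μ) {X | (R X ∩ D).Nonempty}

/-- The acceptance set `A_t` of `R`. -/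
def acceptanceSet : Set (Lp (Fin d → ℝ) p μ) := {X | 0 ∈ R X}

/-- The positive dual cone `A⁺ ⊆ L^q` of `A ⊆ Lᵖ`, as a set of (representatives of) random
vectors. -/
def lpDualCone (q : ℝ≥0∞) (A : Set (Lp (Fin d → ℝ) p μ)) : Set (Ω → Fin d → ℝ) :=
  {v | MemLp v q μ ∧ ∀ Z ∈ A, 0 ≤ ∫ ω, v ω ⬝ᵥ Z ω ∂μ}

variable {m p μ} in
/-- The scalarization `ρ_t^w(X) = ess inf {wᵀu | u ∈ R_t(X)}`. -/
def scalarization (hm : m ≤ mΩ) [IsFiniteMeasure μ] (w : Ω → Fin d → ℝ)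
    (X : Lp (Fin d → ℝ) p μ) : Ω → EReal :=
  famEssInf hm μ fun (u : R X) ω => ((w ω ⬝ᵥ (u : Lp (Fin d → ℝ) p μ) ω : ℝ) : EReal)

end RiskMeasure

/-! ### Dual variables -/

/-- The conditional expectation `E[f | m]` in the extended sense, `E[f⁺ | m] - E[f⁻ | m]`; it
does not ask `f` to be integrable, only that both terms are finite (the value is irrelevant where
they are not). -/
def genCondExp (m : MeasurableSpace Ω) (μ : Measure[mΩ] Ω) (f : Ω → ℝ) : Ω → ℝ := fun ω =>
  (condLExp m μ (fun ω' => ENNReal.ofReal (f ω')) ω).toReal -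
    (condLExp m μ (fun ω' => ENNReal.ofReal (-f ω')) ω).toReal

theorem genCondExp_eq_condExp (m : MeasurableSpace Ω) (μ : Measure[mΩ] Ω) {f : Ω → ℝ}
    (hf : Integrable f μ) : genCondExp m μ f =ᵐ[μ] μ[f | m] := by
  have key : ∀ g : Ω → ℝ, Integrable g μ →
      (fun ω => (condLExp m μ (fun ω' => ENNReal.ofReal (g ω')) ω).toReal) =ᵐ[μ]
        μ[fun ω => max (g ω) 0 | m] := by
    intro g hg
    have h := toReal_condLExp m (μ := μ) (f := fun ω => ENNReal.ofReal (g ω))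
      hg.aemeasurable.ennreal_ofReal (by
        refine ne_top_of_le_ne_top hg.2.ne (lintegral_mono fun ω => ?_)
        exact Real.ofReal_le_enorm _)
    simpa [ENNReal.toReal_ofReal'] using h
  have hsub := condExp_sub (m := m) (hf.pos_part) (hf.neg.pos_part)
  have hid : ((fun ω => max (f ω) 0) - fun ω => max ((-f) ω) 0) = f := by
    funext ω
    simp only [Pi.sub_apply, Pi.neg_apply]
    rcases le_total 0 (f ω) with h | h
    · rw [max_eq_left h, max_eq_right (by linarith)]; ring
    · rw [max_eq_right h, max_eq_left (by linarith)]; ring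
  rw [hid] at hsub
  filter_upwards [key f hf, key (-f) hf.neg, hsub] with ω h1 h2 h3
  simp only [genCondExp]
  simp only [Pi.neg_apply] at h2
  rw [h1, h2, h3]
  rfl

section Dual

variable {ι : Type*} [Preorder ι] (ℱ : Filtration ι mΩ) (μ : Measure Ω)

/-- `𝓜^d`: vectors of probability measures absolutely continuous with respect to `μ`. -/
def measureVectors (d : ℕ) : Set (Fin d → Measure Ω) :=
  {Q | ∀ i, IsProbabilityMeasure (Q i) ∧ Q i ≪ μ}

/-- `E[dν/dμ | ℱ_s]`. -/
def densityAt (s : ι) (ν : Measure Ω) : Ω → ℝ := μ[fun ω => (ν.rnDeriv μ ω).toReal | ℱ s]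

/-- The density quotient `ξ_{s,r}(ν) = E[dν/dμ | ℱ_r] / E[dν/dμ | ℱ_s]`, which is `1` where the
denominator is not positive. -/
def xi (s r : ι) (ν : Measure Ω) : Ω → ℝ := fun ω =>
  open Classical in
  if 0 < densityAt ℱ μ s ν ω then densityAt ℱ μ r ν ω / densityAt ℱ μ s ν ω else 1

variable {d : ℕ}

/-- The `μ`-almost sure version of the conditional expectation, `E^Q[X | ℱ_t]`, componentwise
`E[ξ_{t,T}(Q_i) X_i | ℱ_t]`. -/
def condExpQ (t T : ι) (Q : Fin d → Measure Ω) (X : Ω → Fin d → ℝ) : Ω → Fin d → ℝ :=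
  fun ω i => genCondExp (ℱ t) μ (fun ω' => xi ℱ μ t T (Q i) ω' * X ω' i) ω

/-- `w_t^s(Q, w) = diag(w) ξ_{t,s}(Q)`. -/
def transport (t s : ι) (Q : Fin d → Measure Ω) (w : Ω → Fin d → ℝ) : Ω → Fin d → ℝ :=
  fun ω i => w ω i * xi ℱ μ t s (Q i) ω

variable (M : Submodule ℝ (Fin d → ℝ)) (q : ℝ≥0∞)

/-- The set `𝒲_t` of dual variables. -/
def dualPairs (t T : ι) : Set ((Fin d → Measure Ω) × Lp (Fin d → ℝ) q μ) :=
  {x | x.1 ∈ measureVectors μ d ∧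
    x.2 ∈ LpIn (ℱ t) q μ (fun _ => dualCone (posPart M) \ perp M) ∧
    MemLp (transport ℱ μ t T x.1 x.2) q μ ∧
    ∀ᵐ ω ∂μ, 0 ≤ transport ℱ μ t T x.1 x.2 ω}

/-- `𝒲_t(w)`: the pairs `(Q, m_⊥) ∈ 𝓜^d × L^q_t(M^⊥)` with `(Q, w + m_⊥) ∈ 𝒲_t`. -/
def dualPairsAt (t T : ι) (w : Lp (Fin d → ℝ) q μ) :
    Set ((Fin d → Measure Ω) × Lp (Fin d → ℝ) q μ) :=
  {x | x.1 ∈ measureVectors μ d ∧ x.2 ∈ LpIn (ℱ t) q μ (fun _ => perp M) ∧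
    (x.1, w + x.2) ∈ dualPairs ℱ μ M q t T}

/-- `𝒲_t^R(w)`: the pairs `(Q, m_⊥) ∈ 𝒲_t(w)` with `w_t^T(Q, w + m_⊥) ∈ A_t⁺`. -/
def coherentDualPairs (t T : ι) {p : ℝ≥0∞} [Fact (1 ≤ p)]
    (R : Lp (Fin d → ℝ) p μ → Set (Lp (Fin d → ℝ) p μ)) (w : Lp (Fin d → ℝ) q μ) :
    Set ((Fin d → Measure Ω) × Lp (Fin d → ℝ) q μ) :=
  {x | x ∈ dualPairsAt ℱ μ M q t T w ∧
    transport ℱ μ t T x.1 ⇑(w + x.2) ∈ lpDualCone p μ q (acceptanceSet p μ R)}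

end Dual

end

end SetRisk

/-! The formula is a weak and a strong duality, joined by comparing expectations.

Weak duality (`dualValue_le_dotProduct`). If `u ∈ R X`, then `X + u` is acceptable, so a transported
weight `v ∈ A_t⁺` satisfies `E[vᵀ(X + u)] ≥ 0`. Conditional positive homogeneity localises this to
`E[vᵀ(X + u) | ℱ_t] ≥ 0`. The density quotients have conditional mean 1 and `m_⊥` annihilates `u`,
so the dual value is at most `wᵀu`. Hence the essential supremum is at most `ρ`.

Strong duality in expectation (`exists_lt_integral_dualValue`). Let `a < E[wᵀu]` for every `u ∈ R
X`. The positions having a compensating portfolio `u` with `E[wᵀu] ≤ 0` form a convex cone, closed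
by convex upper continuity. Shifting `X` by an eligible constant portfolio of price `a` gives a
point outside it. A separating functional, suitably scaled, is some `v ≥ 0` in `A_t⁺` that prices
eligible portfolios as `w` does and has `E[-vᵀX] > a` (`exists_memLp_lt_neg_integral`). Such a `v`
factors as `diag(E[v | ℱ_t]) ξ(Q)`, and `E[v | ℱ_t] - w` lies in `M^⊥`, so `v` comes from a dual
pair (`exists_mem_coherentDualPairs`).

Every `a < E[ρ]` qualifies, because `ρ ≤ wᵀu`. So the essential supremum lies below the integrable
`ρ` while its expectation is at least `E[ρ]`, which forces equality
(`IsFamEssSup.ae_eq_of_integral`). Neither family has to be directed. -/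

namespace SetRisk

/-! ### Positive functionals on `Lᵖ` -/

section Riesz

open Filter Topology NNReal

variable {Ω : Type*} {mΩ : MeasurableSpace Ω} {μ : Measure Ω} [IsFiniteMeasure μ]
  {p : ℝ≥0∞} [Fact (1 ≤ p)]

/-- Finite additivity is linearity of `φ`. Countable additivity needs `p < ∞`: only then do the
indicators of the partial unions converge in norm to the indicator of the whole union. -/
theorem exists_measure_of_positive (hp : p ≠ ∞) (φ : Lp ℝ p μ →L[ℝ] ℝ)
    (hφ : ∀ f : Lp ℝ p μ, 0 ≤ᵐ[μ] f → 0 ≤ φ f) :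
    ∃ ν : Measure Ω, IsFiniteMeasure ν ∧ ∀ s (hs : MeasurableSet s),
      ν s = ENNReal.ofReal (φ (indicatorConstLp p hs (measure_ne_top μ s) 1)) := by
  have hpos : ∀ s (hs : MeasurableSet s),
      0 ≤ φ (indicatorConstLp p hs (measure_ne_top μ s) 1) := by
    intro s hs
    refine hφ _ ?_
    filter_upwards [indicatorConstLp_coeFn (p := p) (hs := hs) (hμs := measure_ne_top μ s)
      (c := (1 : ℝ))] with ω hω
    rw [hω]
    exact indicator_nonneg (fun _ _ => zero_le_one) ω
  refine ⟨Measure.ofMeasurable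
    (fun s hs => ENNReal.ofReal (φ (indicatorConstLp p hs (measure_ne_top μ s) 1)))
    (by simp) ?_, ⟨?_⟩, fun s hs => Measure.ofMeasurable_apply s hs⟩
  · intro f hf hd
    have hfin : ∀ n, MeasurableSet (⋃ i < n, f i) := fun n =>
      MeasurableSet.iUnion fun i => MeasurableSet.iUnion fun _ => hf i
    have hsum : ∀ n, φ (indicatorConstLp p (hfin n) (measure_ne_top μ _) 1) =
        ∑ i ∈ Finset.range n, φ (indicatorConstLp p (hf i) (measure_ne_top μ _) 1) := by
      intro n
      induction n with
      | zero => simp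
      | succ n ih =>
        rw [Finset.sum_range_succ, ← ih, ← map_add, ← indicatorConstLp_disjoint_union]
        · congr 2
          ext x
          simp only [mem_union, mem_iUnion, exists_prop, Nat.lt_succ_iff_lt_or_eq]
          constructor
          · rintro ⟨i, hi | rfl, hx⟩
            exacts [Or.inl ⟨i, hi, hx⟩, Or.inr hx]
          · rintro (⟨i, hi, hx⟩ | hx)
            exacts [⟨i, Or.inl hi, hx⟩, ⟨n, Or.inr rfl, hx⟩]
        · simp only [disjoint_iUnion_left]
          intro i hi
          exact hd hi.ne
    have hlim : Tendsto (fun n => φ (indicatorConstLp p (hfin n) (measure_ne_top μ _) 1)) atTop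
        (𝓝 (φ (indicatorConstLp p (MeasurableSet.iUnion hf) (measure_ne_top μ _) 1))) := by
      refine (φ.continuous.tendsto _).comp (tendsto_indicatorConstLp_set hp ?_)
      have hsub : ∀ n, (⋃ i < n, f i) ⊆ ⋃ i, f i := fun n =>
        iUnion₂_subset fun i _ => subset_iUnion f i
      have h0 : ∀ n, symmDiff (⋃ i < n, f i) (⋃ i, f i) = (⋃ i, f i) \ ⋃ i < n, f i := by
        intro n
        rw [symmDiff_of_le (hsub n)]
      simp_rw [h0]
      have hI : ⋂ n, ((⋃ i, f i) \ ⋃ i < n, f i) = ∅ := by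
        ext x
        simp only [mem_iInter, Set.mem_sdiff, mem_iUnion, exists_prop, mem_empty_iff_false, iff_false]
        intro h
        obtain ⟨i, hi⟩ := (h 0).1
        exact (h (i + 1)).2 ⟨i, Nat.lt_succ_self i, hi⟩
      rw [← measure_empty (μ := μ), ← hI]
      refine tendsto_measure_iInter_atTop
        (fun n => ((MeasurableSet.iUnion hf).diff (hfin n)).nullMeasurableSet) ?_
        ⟨0, measure_ne_top μ _⟩
      intro a b hab
      refine sdiff_subset_sdiff_right (iUnion₂_subset fun i hi => ?_)
      exact subset_biUnion_of_mem (u := f) (show i ∈ {i | i < b} from lt_of_lt_of_le hi hab)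
    have hs : HasSum (fun i => φ (indicatorConstLp p (hf i) (measure_ne_top μ _) 1))
        (φ (indicatorConstLp p (MeasurableSet.iUnion hf) (measure_ne_top μ _) 1)) := by
      rw [hasSum_iff_tendsto_nat_of_nonneg fun i => hpos _ _]
      simpa only [hsum] using hlim
    rw [← hs.tsum_eq, ENNReal.ofReal_tsum_of_nonneg (fun i => hpos _ _) hs.summable]
  · rw [Measure.ofMeasurable_apply _ MeasurableSet.univ]
    exact ENNReal.ofReal_lt_top

theorem memLp_simpleFunc_nnreal (p : ℝ≥0∞) (g : SimpleFunc Ω ℝ≥0) :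
    MemLp (fun ω => (g ω : ℝ)) p μ :=
  SimpleFunc.memLp_of_finite_measure_preimage (f := g.map ((↑) : ℝ≥0 → ℝ)) p
    fun _ _ => measure_lt_top μ _

theorem lintegral_simpleFunc_eq_of_measure_eq (φ : Lp ℝ p μ →L[ℝ] ℝ)
    (hφ : ∀ f : Lp ℝ p μ, 0 ≤ᵐ[μ] f → 0 ≤ φ f) {ν : Measure Ω}
    (hν : ∀ s (hs : MeasurableSet s),
      ν s = ENNReal.ofReal (φ (indicatorConstLp p hs (measure_ne_top μ s) 1)))
    (g : SimpleFunc Ω ℝ≥0) :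
    ∫⁻ ω, g ω ∂ν = ENNReal.ofReal (φ ((memLp_simpleFunc_nnreal p g).toLp)) := by
  classical
  have hnn : ∀ g : SimpleFunc Ω ℝ≥0, 0 ≤ φ ((memLp_simpleFunc_nnreal p g).toLp) := by
    intro g
    refine hφ _ ?_
    filter_upwards [(memLp_simpleFunc_nnreal (μ := μ) p g).coeFn_toLp] with ω hω
    rw [hω]
    exact (g ω).2
  induction g using SimpleFunc.induction with
  | @const c s hs =>
    have h1 : (memLp_simpleFunc_nnreal p (SimpleFunc.piecewise s hs (SimpleFunc.const Ω c)
        (SimpleFunc.const Ω 0))).toLp = (c : ℝ) •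
          indicatorConstLp p hs (measure_ne_top μ s) (1 : ℝ) := by
      ext1
      filter_upwards [(memLp_simpleFunc_nnreal (μ := μ) p (SimpleFunc.piecewise s hs
        (SimpleFunc.const Ω c) (SimpleFunc.const Ω 0))).coeFn_toLp,
        Lp.coeFn_smul (c : ℝ) (indicatorConstLp p hs (measure_ne_top μ s) (1 : ℝ)),
        indicatorConstLp_coeFn (p := p) (hs := hs) (hμs := measure_ne_top μ s)
          (c := (1 : ℝ))] with ω h1 h2 h3
      rw [h1, h2, Pi.smul_apply, h3]
      by_cases hω : ω ∈ s <;> simp [hω]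
    rw [h1, map_smul, smul_eq_mul, ENNReal.ofReal_mul (NNReal.coe_nonneg c), ← hν s hs]
    have : ∀ ω, ((SimpleFunc.piecewise s hs (SimpleFunc.const Ω c) (SimpleFunc.const Ω 0) ω : ℝ≥0)
        : ℝ≥0∞) = s.indicator (fun _ => (c : ℝ≥0∞)) ω := by
      intro ω
      by_cases hω : ω ∈ s <;> simp [hω]
    simp_rw [this]
    rw [lintegral_indicator_const hs]
    simp
  | @add f g hfg hf hg =>
    have h1 : (memLp_simpleFunc_nnreal p (f + g)).toLp =
        (memLp_simpleFunc_nnreal p f).toLp + (memLp_simpleFunc_nnreal (μ := μ) p g).toLp := by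
      rw [← MemLp.toLp_add]
      congr 1
    rw [h1, map_add, ENNReal.ofReal_add (hnn f) (hnn g), ← hf, ← hg, ← lintegral_add_left]
    · simp
    · exact f.measurable.coe_nnreal_ennreal

/-- The integral is a supremum over simple functions below `f`, and on those integration against `ν`
is `φ`, which the operator norm bounds. -/
theorem lintegral_le_of_measure_eq (φ : Lp ℝ p μ →L[ℝ] ℝ)
    (hφ : ∀ f : Lp ℝ p μ, 0 ≤ᵐ[μ] f → 0 ≤ φ f) {ν : Measure Ω}
    (hν : ∀ s (hs : MeasurableSet s),
      ν s = ENNReal.ofReal (φ (indicatorConstLp p hs (measure_ne_top μ s) 1)))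
    (f : Ω → ℝ≥0∞) :
    ∫⁻ ω, f ω ∂ν ≤ ENNReal.ofReal ‖φ‖ * eLpNorm f p μ := by
  rw [lintegral_eq_nnreal]
  refine iSup₂_le fun g hg => ?_
  have h1 : (g.map ((↑) : ℝ≥0 → ℝ≥0∞)).lintegral ν = ∫⁻ ω, g ω ∂ν := by
    rw [← SimpleFunc.lintegral_eq_lintegral]
    simp
  rw [h1, lintegral_simpleFunc_eq_of_measure_eq φ hφ hν]
  have h2 := (le_abs_self _).trans (φ.le_opNorm ((memLp_simpleFunc_nnreal p g).toLp))
  refine (ENNReal.ofReal_le_ofReal h2).trans ?_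
  rw [ENNReal.ofReal_mul (norm_nonneg _), Lp.norm_toLp,
    ENNReal.ofReal_toReal (memLp_simpleFunc_nnreal p g).eLpNorm_ne_top]
  gcongr
  refine eLpNorm_mono_enorm fun ω => ?_
  refine le_trans (le_of_eq ?_) (hg ω)
  rw [Real.enorm_eq_ofReal (NNReal.coe_nonneg (g ω))]
  simp

/-- A function that is dominated by the `Lᵖ` norm when integrated against nonnegative functions
belongs to the dual exponent space. -/
theorem eLpNorm_lt_top_of_forall_lintegral_mul_le {q : ℝ≥0∞} [ENNReal.HolderConjugate p q]
    (hp : p ≠ ∞) {V : Ω → ℝ≥0∞} (hV : Measurable V) {C : ℝ≥0∞} (hC : C ≠ ∞)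
    (h : ∀ f : Ω → ℝ≥0∞, Measurable f → ∫⁻ ω, V ω * f ω ∂μ ≤ C * eLpNorm f p μ) :
    eLpNorm V q μ < ∞ := by
  have hp1 : 1 ≤ p := Fact.out
  rcases eq_or_lt_of_le hp1 with rfl | hp1
  · have hq : q = ∞ := by
      rw [ENNReal.HolderConjugate.unique 1 q ∞]
    subst hq
    -- Indicators as test functions give `∫_s V ≤ C μ(s)` for every measurable `s`.
    have hle : V ≤ᵐ[μ] fun _ => C := by
      refine ae_le_of_forall_setLIntegral_le_of_sigmaFinite hV fun s hs _ => ?_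
      have h1 := h (s.indicator 1) (measurable_one.indicator hs)
      have h2 : ∀ ω, V ω * s.indicator 1 ω = s.indicator V ω := by
        intro ω; by_cases hω : ω ∈ s <;> simp [hω]
      simp_rw [h2] at h1
      rw [lintegral_indicator hs, eLpNorm_one_eq_lintegral_enorm] at h1
      simp only [enorm_eq_self] at h1
      rw [lintegral_indicator_one hs] at h1
      simpa using h1
    rw [eLpNorm_exponent_top]
    refine lt_of_le_of_lt (essSup_le_of_ae_le C ?_) hC.lt_top
    simpa using hle
  · have hq1 : q ≠ ∞ := by
      intro hq
      subst hq
      exact hp1.ne' (ENNReal.HolderConjugate.unique ∞ p 1)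
    have hpq : p.toReal.HolderConjugate q.toReal :=
      ENNReal.HolderConjugate.toReal_of_ne_top hp hq1
    have hq0 : q ≠ 0 := by
      intro h0
      simpa [h0] using hpq.symm.pos
    have hp0 : p ≠ 0 := (zero_lt_one.trans hp1).ne'
    set r := q.toReal with hr
    have hr1 : 1 < r := hpq.symm.lt
    have hr0 : 0 < r := hpq.symm.pos
    have hbound : ∀ n : ℕ, ∫⁻ ω, (min (V ω) n) ^ r ∂μ ≤ C ^ r := by
      intro n
      set I := ∫⁻ ω, (min (V ω) n) ^ r ∂μ with hI
      -- The truncation at `n` is there for this finiteness, which allows a power of `I` to be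
      -- cancelled below.
      have hIfin : I ≠ ∞ := by
        refine ne_top_of_le_ne_top (b := ∫⁻ _, (n : ℝ≥0∞) ^ r ∂μ) ?_
          (lintegral_mono fun ω => ENNReal.rpow_le_rpow (min_le_right _ _) hr0.le)
        rw [lintegral_const]
        exact ENNReal.mul_ne_top (ENNReal.rpow_ne_top_of_nonneg hr0.le (by simp))
          (measure_ne_top μ _)
      -- The extremal function of Hölder's inequality for the truncated `V`: since `(r - 1) p = r`,
      -- its `Lᵖ` norm is `I ^ (1 / p)`. This gives `I ≤ C * I ^ (1 / p)`, hence `I ^ (1 / r) ≤ C`,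
      -- uniformly in `n`.
      have h1 := h (fun ω => (min (V ω) n) ^ (r - 1)) (by fun_prop)
      have h2 : I ≤ ∫⁻ ω, V ω * (min (V ω) n) ^ (r - 1) ∂μ := by
        refine lintegral_mono fun ω => ?_
        calc (min (V ω) n) ^ r = min (V ω) n ^ (1 + (r - 1)) := by ring_nf
          _ = min (V ω) n * min (V ω) n ^ (r - 1) := by
              rw [ENNReal.rpow_add_of_nonneg _ _ zero_le_one (by linarith), ENNReal.rpow_one]
          _ ≤ _ := by gcongr; exact min_le_left _ _
      have h3 : eLpNorm (fun ω => (min (V ω) n) ^ (r - 1)) p μ = I ^ (1 / p.toReal) := by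
        rw [eLpNorm_eq_lintegral_rpow_enorm_toReal hp0 hp]
        congr 1
        refine lintegral_congr fun ω => ?_
        rw [enorm_eq_self, ← ENNReal.rpow_mul, hpq.symm.sub_one_mul_conj]
      rw [h3] at h1
      have h4 : I ≤ C * I ^ (1 / p.toReal) := h2.trans h1
      rcases eq_or_ne I 0 with h0 | h0
      · rw [h0]; exact zero_le
      have h5 : I = I ^ (1 / r) * I ^ (1 / p.toReal) := by
        rw [← ENNReal.rpow_add _ _ h0 hIfin]
        have : 1 / r + 1 / p.toReal = 1 := by
          have := hpq.inv_add_inv_eq_one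
          simp only [one_div]; linarith
        rw [this, ENNReal.rpow_one]
      have h6 : I ^ (1 / r) ≤ C := by
        refine (ENNReal.mul_le_mul_iff_left (c := I ^ (1 / p.toReal)) ?_ ?_).1 (h5 ▸ h4)
        · exact (ENNReal.rpow_pos (pos_iff_ne_zero.2 h0) hIfin).ne'
        · exact ENNReal.rpow_ne_top_of_nonneg (by positivity) hIfin
      calc I = (I ^ (1 / r)) ^ r := by
            rw [← ENNReal.rpow_mul, one_div_mul_cancel hr0.ne', ENNReal.rpow_one]
        _ ≤ C ^ r := ENNReal.rpow_le_rpow h6 hr0.le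
    have hfin : ∫⁻ ω, V ω ^ r ∂μ ≤ C ^ r := by
      have hsup : ∀ ω, V ω ^ r = ⨆ n : ℕ, (min (V ω) n) ^ r := by
        intro ω
        have h1 : V ω = ⨆ n : ℕ, min (V ω) n := by
          rw [← inf_iSup_eq, ENNReal.iSup_natCast, inf_top_eq]
        conv_lhs => rw [h1]
        exact (ENNReal.orderIsoRpow r hr0).map_iSup _
      simp_rw [hsup]
      rw [lintegral_iSup]
      · exact iSup_le hbound
      · intro n; fun_prop
      · intro a b hab ω
        exact ENNReal.rpow_le_rpow (min_le_min_left _ (by exact_mod_cast hab)) hr0.le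
    rw [eLpNorm_lt_top_iff_lintegral_rpow_enorm_lt_top hq0 hq1]
    simp only [enorm_eq_self]
    exact hfin.trans_lt (ENNReal.rpow_lt_top_of_nonneg hr0.le hC)

/-- The Riesz representation of positive functionals on `Lᵖ`, `p < ∞`. -/
theorem exists_memLp_eq_integral_of_positive {q : ℝ≥0∞} [ENNReal.HolderConjugate p q]
    (hp : p ≠ ∞) (φ : Lp ℝ p μ →L[ℝ] ℝ) (hφ : ∀ f : Lp ℝ p μ, 0 ≤ᵐ[μ] f → 0 ≤ φ f) :
    ∃ v : Ω → ℝ, MemLp v q μ ∧ ∀ f : Lp ℝ p μ, φ f = ∫ ω, v ω * f ω ∂μ := by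
  obtain ⟨ν, hνfin, hν⟩ := exists_measure_of_positive hp φ hφ
  have hac : ν ≪ μ := by
    refine Measure.AbsolutelyContinuous.mk fun s hs h0 => ?_
    rw [hν s hs]
    have : indicatorConstLp p hs (measure_ne_top μ s) (1 : ℝ) = 0 := by
      ext1
      filter_upwards [indicatorConstLp_coeFn (p := p) (hs := hs) (hμs := measure_ne_top μ s)
        (c := (1 : ℝ)), Lp.coeFn_zero ℝ p μ, measure_eq_zero_iff_ae_notMem.1 h0] with ω h1 h2 h3
      rw [h1, h2]
      simp [h3]
    rw [this]
    simp
  set V := ν.rnDeriv μ with hVdef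
  have hV : Measurable V := Measure.measurable_rnDeriv ν μ
  have hνV : μ.withDensity V = ν := Measure.withDensity_rnDeriv_eq ν μ hac
  have hVq : eLpNorm V q μ < ∞ := by
    refine eLpNorm_lt_top_of_forall_lintegral_mul_le (p := p) hp hV
      (C := ENNReal.ofReal ‖φ‖) ENNReal.ofReal_ne_top fun f hf => ?_
    have := lintegral_le_of_measure_eq φ hφ hν f
    rw [← hνV, lintegral_withDensity_eq_lintegral_mul _ hV hf] at this
    exact this
  have hVtop : ∀ᵐ ω ∂μ, V ω < ∞ := Measure.rnDeriv_lt_top ν μ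
  have hv : MemLp (fun ω => (V ω).toReal) q μ := by
    refine ⟨hV.ennreal_toReal.aestronglyMeasurable, lt_of_le_of_lt ?_ hVq⟩
    refine eLpNorm_mono_enorm_ae ?_
    filter_upwards [hVtop] with ω hω
    rw [Real.enorm_eq_ofReal ENNReal.toReal_nonneg, ENNReal.ofReal_toReal hω.ne, enorm_eq_self]
  refine ⟨_, hv, ?_⟩
  have : Fact (1 ≤ q) := ⟨ENNReal.HolderConjugate.one_le q p⟩
  let ψ : Lp ℝ p μ →L[ℝ] ℝ := (ContinuousLinearMap.mul ℝ ℝ).lpPairing μ q p hv.toLp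
  have hψ : ∀ f : Lp ℝ p μ, ψ f = ∫ ω, (V ω).toReal * f ω ∂μ := by
    intro f
    simp only [ψ, ContinuousLinearMap.lpPairing_eq_integral]
    refine integral_congr_ae ?_
    filter_upwards [hv.coeFn_toLp] with ω hω
    simp [hω]
  intro f
  rw [← hψ f]
  refine Lp.induction hp (fun f => φ f = ψ f) ?_ ?_ ?_ f
  · intro c s hs hμs
    have hcs : ∀ χ : Lp ℝ p μ →L[ℝ] ℝ,
        χ (indicatorConstLp p hs hμs.ne c) = c * χ (indicatorConstLp p hs hμs.ne 1) := by
      intro χ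
      rw [← smul_eq_mul, ← map_smul]
      congr 1
      ext1
      filter_upwards [Lp.coeFn_smul c (indicatorConstLp p hs hμs.ne (1 : ℝ)),
        indicatorConstLp_coeFn (p := p) (hs := hs) (hμs := hμs.ne) (c := (1 : ℝ)),
        indicatorConstLp_coeFn (p := p) (hs := hs) (hμs := hμs.ne) (c := c)] with ω h1 h2 h3
      rw [h1, Pi.smul_apply, h2, h3]
      by_cases hω : ω ∈ s <;> simp [hω]
    have hcoe : ((Lp.simpleFunc.indicatorConst p hs hμs.ne c : Lp.simpleFunc ℝ p μ) : Lp ℝ p μ) =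
        indicatorConstLp p hs hμs.ne c := Lp.simpleFunc.coe_indicatorConst hs hμs.ne c
    rw [hcoe, hcs φ, hcs ψ, hψ]
    congr 1
    have h0 : 0 ≤ φ (indicatorConstLp p hs hμs.ne 1) := by
      refine hφ _ ?_
      filter_upwards [indicatorConstLp_coeFn (p := p) (hs := hs) (hμs := hμs.ne)
        (c := (1 : ℝ))] with ω hω
      rw [hω]
      exact indicator_nonneg (fun _ _ => zero_le_one) ω
    have h1 : ∫ ω, (V ω).toReal * indicatorConstLp p hs hμs.ne (1 : ℝ) ω ∂μ =
        ∫ ω in s, (V ω).toReal ∂μ := by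
      rw [← integral_indicator hs]
      refine integral_congr_ae ?_
      filter_upwards [indicatorConstLp_coeFn (p := p) (hs := hs) (hμs := hμs.ne)
        (c := (1 : ℝ))] with ω hω
      rw [hω]
      by_cases hω : ω ∈ s <;> simp [hω]
    rw [h1, Measure.setIntegral_toReal_rnDeriv hac, Measure.real, hν s hs,
      ENNReal.toReal_ofReal h0]
  · intro f g hf hg _ h1 h2
    rw [map_add, map_add, h1, h2]
  · exact isClosed_eq φ.continuous ψ.continuous

end Riesz

/-! ### Pairing of `Lᵖ` and `L^q`, separation of cones -/

section Separation

open Filter Topology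

/-- A point outside a closed convex cone is separated from it by a continuous functional. -/
theorem exists_strongDual_of_notMem_cone {E : Type*} [AddCommGroup E] [Module ℝ E]
    [TopologicalSpace E] [IsTopologicalAddGroup E] [ContinuousSMul ℝ E] [LocallyConvexSpace ℝ E]
    {B : Set E} (hconv : Convex ℝ B) (hclosed : IsClosed B) (h0 : (0 : E) ∈ B)
    (hsmul : ∀ c : ℝ, 0 < c → ∀ Z ∈ B, c • Z ∈ B) {z : E} (hz : z ∉ B) :
    ∃ f : StrongDual ℝ E, (∀ Z ∈ B, 0 ≤ f Z) ∧ f z < 0 := by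
  obtain ⟨f, u, hfz, hfB⟩ := geometric_hahn_banach_point_closed hconv hclosed hz
  have hu : u < 0 := by simpa using hfB 0 h0
  refine ⟨f, fun Z hZ => ?_, hfz.trans hu⟩
  -- Scaling `Z` by `u / f Z > 0` gives a point of the cone where `f` equals `u`, against the strict
  -- bound.
  by_contra! hneg
  have h1 := hfB _ (hsmul (u / f Z) (div_pos_of_neg_of_neg hu hneg) Z hZ)
  rw [map_smul, smul_eq_mul, div_mul_cancel₀ _ hneg.ne] at h1
  exact lt_irrefl _ h1

variable {Ω : Type*} {mΩ : MeasurableSpace Ω} {μ : Measure Ω} {d : ℕ}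
  {p q : ℝ≥0∞}

/-- The dot product as a continuous bilinear map. -/
noncomputable def dotL (d : ℕ) : (Fin d → ℝ) →L[ℝ] (Fin d → ℝ) →L[ℝ] ℝ :=
  ∑ i, (ContinuousLinearMap.mul ℝ ℝ).bilinearComp (ContinuousLinearMap.proj i)
    (ContinuousLinearMap.proj i)

theorem dotL_apply (x y : Fin d → ℝ) : dotL d x y = x ⬝ᵥ y := by
  simp [dotL, dotProduct]

theorem integrable_dotProduct [ENNReal.HolderConjugate p q] {v Z : Ω → Fin d → ℝ}
    (hv : MemLp v q μ) (hZ : MemLp Z p μ) : Integrable (fun ω => v ω ⬝ᵥ Z ω) μ := by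
  have : ENNReal.HolderConjugate q p := ENNReal.HolderConjugate.symm
  have h := (dotL d).memLp_of_bilin 1 hv hZ
  simpa only [dotL_apply, memLp_one_iff_integrable] using h

theorem integrable_mul_coord [ENNReal.HolderConjugate p q] {v Z : Ω → Fin d → ℝ}
    (hv : MemLp v q μ) (hZ : MemLp Z p μ) (i : Fin d) :
    Integrable (fun ω => v ω i * Z ω i) μ := by
  have : ENNReal.HolderConjugate q p := ENNReal.HolderConjugate.symm
  exact (hv.eval i).integrable_mul (hZ.eval i)

/-- The continuous functional `Z ↦ E[vᵀZ]` on `Lᵖ`. -/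
theorem exists_continuousLinearMap_eq_integral [Fact (1 ≤ p)] [ENNReal.HolderConjugate p q]
    {v : Ω → Fin d → ℝ} (hv : MemLp v q μ) :
    ∃ φ : Lp (Fin d → ℝ) p μ →L[ℝ] ℝ, ∀ Z, φ Z = ∫ ω, v ω ⬝ᵥ Z ω ∂μ := by
  have : ENNReal.HolderConjugate q p := ENNReal.HolderConjugate.symm
  have : Fact (1 ≤ q) := ⟨ENNReal.HolderConjugate.one_le q p⟩
  refine ⟨(dotL d).lpPairing μ q p hv.toLp, fun Z => ?_⟩
  rw [ContinuousLinearMap.lpPairing_eq_integral]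
  refine integral_congr_ae ?_
  filter_upwards [hv.coeFn_toLp] with ω hω
  rw [hω, dotL_apply]

theorem lpTopology_top : lpTopology (d := d) ∞ μ = TopologicalSpace.induced
    (fun (X : Lp (Fin d → ℝ) ∞ μ) (Y : Lp (Fin d → ℝ) 1 μ) => ∫ ω, Y ω ⬝ᵥ X ω ∂μ)
      Pi.topologicalSpace := by
  unfold lpTopology
  rw [if_pos rfl]

theorem lpTopology_of_ne_top [Fact (1 ≤ p)] (hp : p ≠ ∞) :
    lpTopology (d := d) p μ = (inferInstance : TopologicalSpace (Lp (Fin d → ℝ) p μ)) := by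
  unfold lpTopology
  rw [if_neg hp]

theorem continuous_lpTopology_integral [Fact (1 ≤ p)] [ENNReal.HolderConjugate p q]
    {v : Ω → Fin d → ℝ} (hv : MemLp v q μ) :
    @Continuous _ _ (lpTopology p μ) _ (fun Z : Lp (Fin d → ℝ) p μ => ∫ ω, v ω ⬝ᵥ Z ω ∂μ) := by
  by_cases hp : p = ∞
  · subst hp
    have hq : q = 1 := ENNReal.HolderConjugate.unique ∞ q 1
    subst hq
    have h : (fun Z : Lp (Fin d → ℝ) ∞ μ => ∫ ω, v ω ⬝ᵥ Z ω ∂μ) =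
        (fun g : Lp (Fin d → ℝ) 1 μ → ℝ => g hv.toLp) ∘
        fun (X : Lp (Fin d → ℝ) ∞ μ) (Y : Lp (Fin d → ℝ) 1 μ) => ∫ ω, Y ω ⬝ᵥ X ω ∂μ := by
      funext Z
      refine integral_congr_ae ?_
      filter_upwards [hv.coeFn_toLp] with ω hω
      rw [hω]
    rw [h, lpTopology_top]
    exact @Continuous.comp _ _ _ (_) _ _ _ _ (continuous_apply _) continuous_induced_dom
  · obtain ⟨φ, hφ⟩ := exists_continuousLinearMap_eq_integral (p := p) hv
    simp_rw [← hφ]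
    rw [lpTopology_of_ne_top hp]
    exact φ.continuous

theorem norm_topology_le_lpTopology [Fact (1 ≤ p)] :
    (inferInstance : TopologicalSpace (Lp (Fin d → ℝ) p μ)) ≤ lpTopology p μ := by
  by_cases hp : p = ∞
  · subst hp
    rw [lpTopology_top, ← continuous_iff_le_induced]
    refine continuous_pi fun Y => ?_
    obtain ⟨φ, hφ⟩ := exists_continuousLinearMap_eq_integral (p := ∞) (q := 1) (Lp.memLp Y)
    simp_rw [← hφ]
    exact φ.continuous
  · exact (lpTopology_of_ne_top hp).ge

theorem isClosed_of_isClosed_lpTopology [Fact (1 ≤ p)] {s : Set (Lp (Fin d → ℝ) p μ)}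
    (hs : @IsClosed _ (lpTopology p μ) s) : IsClosed s :=
  IsClosed.mono hs norm_topology_le_lpTopology

/-- The Riesz representation of positive functionals on `Lᵖ(ℝᵈ)`, `p < ∞`. -/
theorem exists_memLp_eq_integral_dotProduct_of_positive [IsFiniteMeasure μ] [Fact (1 ≤ p)]
    [ENNReal.HolderConjugate p q] (hp : p ≠ ∞) (φ : Lp (Fin d → ℝ) p μ →L[ℝ] ℝ)
    (hφ : ∀ Z : Lp (Fin d → ℝ) p μ, (∀ᵐ ω ∂μ, 0 ≤ Z ω) → 0 ≤ φ Z) :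
    ∃ v : Ω → Fin d → ℝ, MemLp v q μ ∧ ∀ Z, φ Z = ∫ ω, v ω ⬝ᵥ Z ω ∂μ := by
  let J : ∀ i : Fin d, Lp ℝ p μ →L[ℝ] Lp (Fin d → ℝ) p μ := fun i =>
    (ContinuousLinearMap.single ℝ (fun _ : Fin d => ℝ) i).compLpL p μ
  let π : ∀ i : Fin d, Lp (Fin d → ℝ) p μ →L[ℝ] Lp ℝ p μ := fun i =>
    (ContinuousLinearMap.proj (R := ℝ) (φ := fun _ : Fin d => ℝ) i).compLpL p μ
  have hJ : ∀ i f, ∀ᵐ ω ∂μ, J i f ω = Pi.single i (f ω) := fun i f => by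
    filter_upwards [(ContinuousLinearMap.single ℝ (fun _ : Fin d => ℝ) i).coeFn_compLpL f]
      with ω hω
    rw [hω]
    rfl
  have hπ : ∀ i Z, ∀ᵐ ω ∂μ, π i Z ω = Z ω i := fun i Z => by
    filter_upwards [(ContinuousLinearMap.proj (R := ℝ) (φ := fun _ : Fin d => ℝ) i).coeFn_compLpL Z]
      with ω hω
    rw [hω]
    rfl
  have hex : ∀ i, ∃ v : Ω → ℝ, MemLp v q μ ∧ ∀ f : Lp ℝ p μ, (φ.comp (J i)) f =
      ∫ ω, v ω * f ω ∂μ := fun i => by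
    refine exists_memLp_eq_integral_of_positive hp _ fun f hf => hφ _ ?_
    filter_upwards [hJ i f, hf] with ω h1 h2
    exact h1.symm ▸ Pi.single_nonneg.2 h2
  choose v hv hvφ using hex
  have hvL : MemLp (fun ω i => v i ω) q μ := memLp_pi_iff.2 hv
  refine ⟨fun ω i => v i ω, hvL, fun Z => ?_⟩
  have hZ : Z = ∑ i, J i (π i Z) := by
    ext1
    have h1 : ∀ᵐ ω ∂μ, ∀ i, J i (π i Z) ω = Pi.single i (Z ω i) := by
      rw [ae_all_iff]
      intro i
      filter_upwards [hJ i (π i Z), hπ i Z] with ω h1 h2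
      rw [h1, h2]
    filter_upwards [h1, Lp.coeFn_finsetSum Finset.univ fun i => J i (π i Z)] with ω h1 h2
    rw [h2]
    simp only [Finset.sum_apply, h1]
    exact (Finset.univ_sum_single (Z ω)).symm
  conv_lhs => rw [hZ]
  rw [map_sum]
  simp only [dotProduct]
  rw [integral_finsetSum _ fun i _ => integrable_mul_coord hvL (Lp.memLp Z) i]
  refine Finset.sum_congr rfl fun i _ => ?_
  have := hvφ i (π i Z)
  rw [ContinuousLinearMap.comp_apply] at this
  rw [this]
  refine integral_congr_ae ?_
  filter_upwards [hπ i Z] with ω hω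
  rw [hω]

/-- A point outside a closed convex cone that contains `Lᵖ_+` is separated from it by an element
of `L^q`. -/
theorem exists_memLp_of_notMem_cone [IsFiniteMeasure μ] [Fact (1 ≤ p)]
    [ENNReal.HolderConjugate p q] {B : Set (Lp (Fin d → ℝ) p μ)} (hconv : Convex ℝ B)
    (hclosed : @IsClosed _ (lpTopology p μ) B)
    (hpos : ∀ Z : Lp (Fin d → ℝ) p μ, (∀ᵐ ω ∂μ, 0 ≤ Z ω) → Z ∈ B)
    (hsmul : ∀ c : ℝ, 0 < c → ∀ Z ∈ B, c • Z ∈ B) {z : Lp (Fin d → ℝ) p μ} (hz : z ∉ B) :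
    ∃ v : Ω → Fin d → ℝ, MemLp v q μ ∧ (∀ Z ∈ B, 0 ≤ ∫ ω, v ω ⬝ᵥ Z ω ∂μ) ∧
      ∫ ω, v ω ⬝ᵥ z ω ∂μ < 0 := by
  have h0 : (0 : Lp (Fin d → ℝ) p μ) ∈ B := by
    refine hpos 0 ?_
    filter_upwards [Lp.coeFn_zero (Fin d → ℝ) p μ] with ω hω
    rw [hω]
    exact le_rfl
  by_cases hp : p = ∞
  · subst hp
    have hq : q = 1 := ENNReal.HolderConjugate.unique ∞ q 1
    subst hq
    have : ENNReal.HolderConjugate 1 ∞ := ENNReal.HolderConjugate.symm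
    let L := (dotL d).lpPairing μ 1 ∞
    let Bil : Lp (Fin d → ℝ) ∞ μ →ₗ[ℝ] Lp (Fin d → ℝ) 1 μ →ₗ[ℝ] ℝ :=
      LinearMap.mk₂ ℝ (fun X Y => L Y X) (fun _ _ _ => map_add _ _ _) (fun _ _ _ => map_smul _ _ _)
        (fun X Y Y' => by simp) (fun c X Y => by simp)
    have hBil : ∀ X Y, Bil X Y = ∫ ω, Y ω ⬝ᵥ X ω ∂μ := by
      intro X Y
      simp only [Bil, L, LinearMap.mk₂_apply, ContinuousLinearMap.lpPairing_eq_integral, dotL_apply]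
    -- The weak* topology is the weak topology of the bilinear pairing with `L¹`, whose continuous
    -- functionals are exactly the elements of `L¹`; no Riesz theorem is needed in this case.
    have htop : lpTopology (d := d) ∞ μ =
        (inferInstance : TopologicalSpace (WeakBilin Bil)) := by
      rw [lpTopology_top]
      change _ = TopologicalSpace.induced (fun x y => Bil x y) _
      simp_rw [hBil]
    rw [htop] at hclosed
    obtain ⟨f, hfB, hfz⟩ := exists_strongDual_of_notMem_cone (E := WeakBilin Bil)
      (B := B) hconv hclosed h0 hsmul hz
    obtain ⟨y, rfl⟩ := Bil.dualEmbedding_surjective f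
    refine ⟨y, Lp.memLp y, fun Z hZ => ?_, ?_⟩
    · rw [← hBil]
      exact hfB Z hZ
    · rw [← hBil]
      exact hfz
  -- The cone contains `Lᵖ_+`, so the separating functional is positive and the positive Riesz
  -- theorem suffices.
  · obtain ⟨f, hfB, hfz⟩ := exists_strongDual_of_notMem_cone hconv
      (isClosed_of_isClosed_lpTopology hclosed) h0 hsmul hz
    obtain ⟨v, hv, hvf⟩ := exists_memLp_eq_integral_dotProduct_of_positive (q := q) hp f
      fun Z hZ => hfB Z (hpos Z hZ)
    exact ⟨v, hv, fun Z hZ => hvf Z ▸ hfB Z hZ, hvf z ▸ hfz⟩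

end Separation

/-! ### Pulling out measurable factors from conditional expectations -/

section PullOut

variable {Ω : Type*} {m mΩ : MeasurableSpace Ω} {μ : Measure Ω} [IsFiniteMeasure μ]

theorem lintegral_mul_condLExp (hm : m ≤ mΩ) {g : Ω → ℝ≥0∞} (hg : AEMeasurable g μ)
    {a : Ω → ℝ≥0∞} (ha : Measurable[m] a) :
    ∫⁻ ω, a ω * condLExp m μ g ω ∂μ = ∫⁻ ω, a ω * g ω ∂μ := by
  have hc : Measurable (condLExp m μ g) := (measurable_condLExp m μ g).mono hm le_rfl
  refine @Measurable.ennreal_induction Ω m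
    (fun a => ∫⁻ ω, a ω * condLExp m μ g ω ∂μ = ∫⁻ ω, a ω * g ω ∂μ) ?_ ?_ ?_ a ha
  · intro c s hs
    have h : ∀ g : Ω → ℝ≥0∞, ∀ ω, s.indicator (fun _ => c) ω * g ω =
        s.indicator (fun ω => c * g ω) ω := by
      intro g ω
      by_cases hω : ω ∈ s <;> simp [hω]
    simp_rw [h]
    rw [lintegral_indicator (hm s hs), lintegral_indicator (hm s hs), lintegral_const_mul _ hc,
      lintegral_const_mul'' _ hg.restrict, setLIntegral_condLExp hm μ g hs]
  · intro a b _ ha hb iha ihb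
    simp only [Pi.add_apply, add_mul]
    have h1 : Measurable fun ω => a ω * condLExp m μ g ω := (ha.mono hm le_rfl).mul hc
    have h2 : AEMeasurable (fun ω => a ω * g ω) μ := (ha.mono hm le_rfl).aemeasurable.mul hg
    rw [lintegral_add_left h1, iha, ihb, lintegral_add_left' h2]
  · intro a ha hmono ih
    simp only [ENNReal.iSup_mul]
    have h1 : ∀ n, Measurable fun ω => a n ω * condLExp m μ g ω :=
      fun n => ((ha n).mono hm le_rfl).mul hc
    have h2 : ∀ n, AEMeasurable (fun ω => a n ω * g ω) μ :=
      fun n => ((ha n).mono hm le_rfl).aemeasurable.mul hg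
    rw [lintegral_iSup h1 fun i j hij ω => mul_le_mul_left (hmono hij ω) _,
      lintegral_iSup' h2
        (Filter.Eventually.of_forall fun ω i j hij => mul_le_mul_left (hmono hij ω) _)]
    simp_rw [ih]

theorem condLExp_mul_of_measurable_left (hm : m ≤ mΩ) {g : Ω → ℝ≥0∞} (hg : AEMeasurable g μ)
    {a : Ω → ℝ≥0∞} (ha : Measurable[m] a) :
    condLExp m μ (fun ω => a ω * g ω) =ᵐ[μ] fun ω => a ω * condLExp m μ g ω := by
  refine (ae_eq_condLExp hm μ _ (ha.mul (measurable_condLExp m μ g)) fun s hs => ?_).symm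
  have h : ∀ g : Ω → ℝ≥0∞, ∀ ω, s.indicator (fun ω => a ω * g ω) ω = s.indicator a ω * g ω := by
    intro g ω
    by_cases hω : ω ∈ s <;> simp [hω]
  rw [← lintegral_indicator (hm s hs), ← lintegral_indicator (hm s hs)]
  rw [show a * condLExp m μ g = fun ω => a ω * condLExp m μ g ω from rfl]
  simp_rw [h]
  exact lintegral_mul_condLExp hm hg (ha.indicator hs)

/-- Only the product `a * f` is integrable. On the positive and negative parts the factor comes out
in `[0, ∞]` without integrability, and where `a` vanishes the product is zero whatever real value an
infinite conditional expectation receives. -/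
theorem mul_genCondExp_ae_eq (hm : m ≤ mΩ) {a f : Ω → ℝ} (ha : AEStronglyMeasurable[m] a μ)
    (ha0 : 0 ≤ᵐ[μ] a) (hf : AEStronglyMeasurable f μ) (haf : Integrable (fun ω => a ω * f ω) μ) :
    (fun ω => a ω * genCondExp m μ f ω) =ᵐ[μ] μ[fun ω => a ω * f ω | m] := by
  obtain ⟨b, hb, hab⟩ := ha
  have key : ∀ g : Ω → ℝ, AEStronglyMeasurable g μ →
      condLExp m μ (fun ω => ENNReal.ofReal (a ω * g ω)) =ᵐ[μ]
        fun ω => ENNReal.ofReal (a ω) * condLExp m μ (fun ω => ENNReal.ofReal (g ω)) ω := by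
    intro g hg
    have h1 : (fun ω => ENNReal.ofReal (a ω * g ω)) =ᵐ[μ]
        fun ω => ENNReal.ofReal (b ω) * ENNReal.ofReal (g ω) := by
      filter_upwards [hab, ha0] with ω h1 h2
      rw [ENNReal.ofReal_mul h2, h1]
    refine (condLExp_congr_ae h1).trans ((condLExp_mul_of_measurable_left hm
      hg.aemeasurable.ennreal_ofReal hb.measurable.ennreal_ofReal).trans ?_)
    filter_upwards [hab] with ω h1
    rw [h1]
  have hkn := key (-f) hf.neg
  refine Filter.EventuallyEq.trans ?_ (genCondExp_eq_condExp m μ haf)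
  filter_upwards [key f hf, hkn, ha0] with ω h1 h2 h3
  simp only [Pi.neg_apply, mul_neg] at h2
  simp only [genCondExp]
  rw [h1, h2, ENNReal.toReal_mul, ENNReal.toReal_mul, ENNReal.toReal_ofReal h3]
  ring

end PullOut

/-! ### Density quotients -/

section Quotient

variable {Ω : Type*} {m mΩ : MeasurableSpace Ω} {μ : Measure Ω}

/-- The quotient `f / g`, and `1` where `g` is not positive. -/
noncomputable def posQuotient (f g : Ω → ℝ) : Ω → ℝ := fun ω =>
  open Classical in if 0 < g ω then f ω / g ω else 1

theorem measurable_posQuotient {f g : Ω → ℝ} (hf : Measurable f) (hg : Measurable g) :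
    Measurable (posQuotient f g) :=
  Measurable.ite (measurableSet_lt measurable_const hg) (hf.div hg) measurable_const

theorem posQuotient_nonneg {f g : Ω → ℝ} {ω : Ω} (hf : 0 ≤ f ω) : 0 ≤ posQuotient f g ω := by
  unfold posQuotient
  split_ifs with h
  exacts [div_nonneg hf h.le, zero_le_one]

theorem aestronglyMeasurable_posQuotient (hm : m ≤ mΩ) {f g : Ω → ℝ}
    (hf : AEStronglyMeasurable f μ) (hg : Measurable[m] g) :
    AEStronglyMeasurable (posQuotient f g) μ := by
  refine ⟨posQuotient (hf.mk f) g, (measurable_posQuotient hf.stronglyMeasurable_mk.measurable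
    (hg.mono hm le_rfl)).stronglyMeasurable, ?_⟩
  filter_upwards [hf.ae_eq_mk] with ω hω
  simp only [posQuotient, hω]

variable [IsFiniteMeasure μ]

theorem condLExp_ofReal_posQuotient (hm : m ≤ mΩ) {f g : Ω → ℝ} (hfi : Integrable f μ)
    (hf0 : 0 ≤ᵐ[μ] f) (hg : Measurable[m] g) (hfg : g =ᵐ[μ] μ[f | m]) :
    condLExp m μ (fun ω => ENNReal.ofReal (posQuotient f g ω)) =ᵐ[μ] fun _ => 1 := by
  classical
  -- The quotient is written as `a * f + b` with `m`-measurable `a` and `b`, so that only `f` is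
  -- left to be conditioned.
  let a : Ω → ℝ≥0∞ := fun ω => if 0 < g ω then (ENNReal.ofReal (g ω))⁻¹ else 0
  let b : Ω → ℝ≥0∞ := fun ω => if 0 < g ω then 0 else 1
  have hset : MeasurableSet[m] {ω | 0 < g ω} := @measurableSet_lt _ _ _ _ _ m _ _ _ _ _
    measurable_const hg
  have ha : Measurable[m] a := Measurable.ite hset hg.ennreal_ofReal.inv measurable_const
  have hb : Measurable[m] b := Measurable.ite hset measurable_const measurable_const
  have hsplit : (fun ω => ENNReal.ofReal (posQuotient f g ω)) =
      (fun ω => a ω * ENNReal.ofReal (f ω)) + b := by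
    funext ω
    simp only [posQuotient, a, b, Pi.add_apply]
    split_ifs with h
    · rw [ENNReal.ofReal_div_of_pos h, add_zero, mul_comm, div_eq_mul_inv]
    · simp
  rw [hsplit]
  have h1 := condLExp_add_right (P := μ) (mΩ := m) (fun ω => a ω * ENNReal.ofReal (f ω))
    (hb.mono hm le_rfl).aemeasurable
  have h2 := condLExp_mul_of_measurable_left hm hfi.1.aemeasurable.ennreal_ofReal ha
  have h3 := condLExp_ofReal m hfi hf0
  rw [condLExp_eq_self hm μ hb] at h1
  filter_upwards [h1, h2, h3, hfg] with ω h1 h2 h3 h4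
  rw [h1, Pi.add_apply, h2, h3, ← h4]
  simp only [a, b]
  split_ifs with h
  · rw [add_zero, ENNReal.inv_mul_cancel (ENNReal.ofReal_pos.2 h).ne' ENNReal.ofReal_ne_top]
  · simp

theorem lintegral_ofReal_posQuotient (hm : m ≤ mΩ) {f g : Ω → ℝ} (hfi : Integrable f μ)
    (hf0 : 0 ≤ᵐ[μ] f) (hg : Measurable[m] g) (hfg : g =ᵐ[μ] μ[f | m]) :
    ∫⁻ ω, ENNReal.ofReal (posQuotient f g ω) ∂μ = μ univ := by
  rw [← lintegral_condLExp hm, lintegral_congr_ae (condLExp_ofReal_posQuotient hm hfi hf0 hg hfg),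
    lintegral_one]

theorem integrable_posQuotient (hm : m ≤ mΩ) {f g : Ω → ℝ} (hfi : Integrable f μ)
    (hf0 : 0 ≤ᵐ[μ] f) (hg : Measurable[m] g) (hfg : g =ᵐ[μ] μ[f | m]) :
    Integrable (posQuotient f g) μ := by
  refine ⟨aestronglyMeasurable_posQuotient hm hfi.1 hg, ?_⟩
  rw [hasFiniteIntegral_iff_ofReal]
  · rw [lintegral_ofReal_posQuotient hm hfi hf0 hg hfg]
    exact measure_lt_top μ univ
  · filter_upwards [hf0] with ω hω using posQuotient_nonneg hω

theorem condExp_posQuotient (hm : m ≤ mΩ) {f g : Ω → ℝ} (hfi : Integrable f μ)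
    (hf0 : 0 ≤ᵐ[μ] f) (hg : Measurable[m] g) (hfg : g =ᵐ[μ] μ[f | m]) :
    μ[posQuotient f g | m] =ᵐ[μ] fun _ => 1 := by
  have hi := integrable_posQuotient hm hfi hf0 hg hfg
  have h1 := condLExp_ofReal m hi (by
    filter_upwards [hf0] with ω hω using posQuotient_nonneg hω)
  filter_upwards [h1, condLExp_ofReal_posQuotient hm hfi hf0 hg hfg] with ω h1 h2
  rw [h2] at h1
  exact (ENNReal.ofReal_eq_one.1 h1.symm)

/-- The value 1 assigned where `g` is not positive does no harm: `g` is the conditional expectation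
of `f ≥ 0`, so `f` vanishes almost everywhere on `{g ≤ 0}`. -/
theorem mul_posQuotient_ae_eq (hm : m ≤ mΩ) {f g : Ω → ℝ} (hfi : Integrable f μ)
    (hf0 : 0 ≤ᵐ[μ] f) (hg : Measurable[m] g) (hfg : g =ᵐ[μ] μ[f | m]) :
    (fun ω => g ω * posQuotient f g ω) =ᵐ[μ] f := by
  have hset : MeasurableSet[m] {ω | g ω ≤ 0} := @measurableSet_le _ _ _ _ _ m _ _ _ _ _
    hg measurable_const
  have h0 : ∫ ω in {ω | g ω ≤ 0}, f ω ∂μ ≤ 0 := by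
    rw [← setIntegral_condExp hm hfi hset]
    refine setIntegral_nonpos_of_ae_restrict ?_
    filter_upwards [ae_restrict_of_ae hfg, ae_restrict_mem (hm _ hset)] with ω h1 h2
    rw [← h1]
    exact h2
  have h1 : ∫ ω in {ω | g ω ≤ 0}, f ω ∂μ = 0 :=
    le_antisymm h0 (integral_nonneg_of_ae (ae_restrict_of_ae hf0))
  rw [setIntegral_eq_zero_iff_of_nonneg_ae (ae_restrict_of_ae hf0) hfi.integrableOn,
    Filter.EventuallyEq, ae_restrict_iff' (hm _ hset)] at h1
  have hg0 : 0 ≤ᵐ[μ] g := (condExp_nonneg hf0).trans hfg.symm.le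
  filter_upwards [h1, hg0] with ω h1 h2
  simp only [posQuotient]
  split_ifs with h
  · rw [mul_div_cancel₀ _ h.ne']
  · have := h1 (not_lt.1 h)
    rw [this, le_antisymm (not_lt.1 h) h2]
    simp

end Quotient

/-! ### Transported weights -/

section Transport

variable {Ω : Type*} {mΩ : MeasurableSpace Ω} {μ : Measure Ω}
  {ι : Type*} [Preorder ι] {ℱ : Filtration ι mΩ} {t T : ι} {d : ℕ} {p q : ℝ≥0∞}

theorem densityAt_nonneg (s : ι) (ν : Measure Ω) : 0 ≤ᵐ[μ] densityAt ℱ μ s ν :=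
  condExp_nonneg (Filter.Eventually.of_forall fun _ => ENNReal.toReal_nonneg)

theorem measurable_densityAt (s : ι) (ν : Measure Ω) : Measurable[ℱ s] (densityAt ℱ μ s ν) :=
  stronglyMeasurable_condExp.measurable

theorem aestronglyMeasurable_coord {m : MeasurableSpace Ω} {w : Ω → Fin d → ℝ}
    (hw : AEStronglyMeasurable[m] w μ) (i : Fin d) :
    AEStronglyMeasurable[m] (fun ω => w ω i) μ :=
  (continuous_apply i).comp_aestronglyMeasurable hw

theorem aestronglyMeasurable_dotProduct {m : MeasurableSpace Ω} {v w : Ω → Fin d → ℝ}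
    (hv : AEStronglyMeasurable[m] v μ) (hw : AEStronglyMeasurable[m] w μ) :
    AEStronglyMeasurable[m] (fun ω => v ω ⬝ᵥ w ω) μ := by
  have h : Continuous fun x : (Fin d → ℝ) × (Fin d → ℝ) => x.1 ⬝ᵥ x.2 := by fun_prop
  exact h.comp_aestronglyMeasurable (hv.prodMk hw)

theorem condExp_dotProduct {m : MeasurableSpace Ω} {v Z : Ω → Fin d → ℝ}
    (h : ∀ i, Integrable (fun ω => v ω i * Z ω i) μ) :
    μ[fun ω => v ω ⬝ᵥ Z ω | m] =ᵐ[μ] fun ω => ∑ i, (μ[fun ω => v ω i * Z ω i | m]) ω := by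
  have h1 : (fun ω => v ω ⬝ᵥ Z ω) = ∑ i, fun ω => v ω i * Z ω i := by
    funext ω
    simp [dotProduct]
  rw [h1]
  filter_upwards [condExp_finsetSum (s := Finset.univ) (fun i _ => h i) m] with ω hω
  rw [hω, Finset.sum_apply]

variable [IsFiniteMeasure μ]

theorem densityAt_ae_eq_condExp (htT : t ≤ T) (ν : Measure Ω) :
    densityAt ℱ μ t ν =ᵐ[μ] μ[densityAt ℱ μ T ν | ℱ t] :=
  (condExp_condExp_of_le (ℱ.mono htT) (ℱ.le T)).symm

theorem integrable_xi (htT : t ≤ T) (ν : Measure Ω) : Integrable (xi ℱ μ t T ν) μ :=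
  integrable_posQuotient (ℱ.le t) integrable_condExp (densityAt_nonneg T ν)
    (measurable_densityAt t ν) (densityAt_ae_eq_condExp htT ν)

theorem condExp_xi (htT : t ≤ T) (ν : Measure Ω) : μ[xi ℱ μ t T ν | ℱ t] =ᵐ[μ] fun _ => 1 :=
  condExp_posQuotient (ℱ.le t) integrable_condExp (densityAt_nonneg T ν)
    (measurable_densityAt t ν) (densityAt_ae_eq_condExp htT ν)

/-- As `ξ` has conditional mean 1, conditioning the transported weight on `ℱ_t` returns the weight,
and conditioning preserves sign. -/
theorem nonneg_of_transport_nonneg (htT : t ≤ T) (hq : 1 ≤ q) {Q : Fin d → Measure Ω}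
    {w : Ω → Fin d → ℝ} (hw : AEStronglyMeasurable[ℱ t] w μ)
    (hv : MemLp (transport ℱ μ t T Q w) q μ)
    (hv0 : ∀ᵐ ω ∂μ, 0 ≤ transport ℱ μ t T Q w ω) : ∀ᵐ ω ∂μ, 0 ≤ w ω := by
  have h : ∀ i, ∀ᵐ ω ∂μ, 0 ≤ w ω i := by
    intro i
    have h1 : μ[(fun ω => w ω i) * xi ℱ μ t T (Q i) | ℱ t] =ᵐ[μ]
        (fun ω => w ω i) * μ[xi ℱ μ t T (Q i) | ℱ t] :=
      condExp_mul_of_aestronglyMeasurable_left (aestronglyMeasurable_coord hw i)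
        ((hv.eval i).integrable hq) (integrable_xi htT (Q i))
    have h2 : 0 ≤ᵐ[μ] μ[(fun ω => w ω i) * xi ℱ μ t T (Q i) | ℱ t] := by
      refine condExp_nonneg ?_
      filter_upwards [hv0] with ω hω using hω i
    filter_upwards [h1, h2, condExp_xi htT (Q i)] with ω h1 h2 h3
    rw [h1, Pi.mul_apply, h3, mul_one] at h2
    exact h2
  filter_upwards [ae_all_iff.2 h] with ω hω using hω

/-- This turns dual values into ordinary conditional expectations, although `ξ_i Z_i` alone need not
be integrable. -/
theorem dotProduct_condExpQ_ae_eq [ENNReal.HolderConjugate p q]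
    {Q : Fin d → Measure Ω} {w Z : Ω → Fin d → ℝ} (htT : t ≤ T)
    (hw : AEStronglyMeasurable[ℱ t] w μ) (hw0 : ∀ᵐ ω ∂μ, 0 ≤ w ω)
    (hv : MemLp (transport ℱ μ t T Q w) q μ) (hZ : MemLp Z p μ) :
    (fun ω => w ω ⬝ᵥ condExpQ ℱ μ t T Q Z ω) =ᵐ[μ]
      μ[fun ω => transport ℱ μ t T Q w ω ⬝ᵥ Z ω | ℱ t] := by
  have hi := integrable_mul_coord hv hZ
  have h1 : ∀ i, (fun ω => w ω i * condExpQ ℱ μ t T Q Z ω i) =ᵐ[μ]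
      μ[fun ω => transport ℱ μ t T Q w ω i * Z ω i | ℱ t] := by
    intro i
    have := mul_genCondExp_ae_eq (ℱ.le t) (a := fun ω => w ω i)
      (f := fun ω => xi ℱ μ t T (Q i) ω * Z ω i) (aestronglyMeasurable_coord hw i)
      (by filter_upwards [hw0] with ω hω using hω i)
      ((integrable_xi htT (Q i)).1.mul (hZ.eval i).1)
      (by simpa only [transport, mul_assoc] using hi i)
    simpa only [transport, condExpQ, mul_assoc] using this
  filter_upwards [condExp_dotProduct (m := ℱ t) hi, ae_all_iff.2 h1] with ω h2 h3
  rw [h2]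
  exact Finset.sum_congr rfl fun i _ => h3 i

theorem condExp_transport_dotProduct_of_measurable [ENNReal.HolderConjugate p q] (htT : t ≤ T)
    {Q : Fin d → Measure Ω} {w u : Ω → Fin d → ℝ}
    (hw : AEStronglyMeasurable[ℱ t] w μ) (hu : AEStronglyMeasurable[ℱ t] u μ)
    (hv : MemLp (transport ℱ μ t T Q w) q μ) (hup : MemLp u p μ) :
    μ[fun ω => transport ℱ μ t T Q w ω ⬝ᵥ u ω | ℱ t] =ᵐ[μ] fun ω => w ω ⬝ᵥ u ω := by
  have hi := integrable_mul_coord hv hup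
  have h1 : ∀ i, μ[fun ω => transport ℱ μ t T Q w ω i * u ω i | ℱ t] =ᵐ[μ]
      fun ω => w ω i * u ω i := by
    intro i
    have heq : (fun ω => transport ℱ μ t T Q w ω i * u ω i) =
        (fun ω => w ω i * u ω i) * xi ℱ μ t T (Q i) := by
      funext ω
      simp only [transport, Pi.mul_apply]
      ring
    have h2 := hi i
    rw [heq] at h2 ⊢
    have h3 : μ[(fun ω => w ω i * u ω i) * xi ℱ μ t T (Q i) | ℱ t] =ᵐ[μ]
        (fun ω => w ω i * u ω i) * μ[xi ℱ μ t T (Q i) | ℱ t] :=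
      condExp_mul_of_aestronglyMeasurable_left
      ((aestronglyMeasurable_coord hw i).mul (aestronglyMeasurable_coord hu i)) h2
      (integrable_xi htT (Q i))
    filter_upwards [h3, condExp_xi (μ := μ) (ℱ := ℱ) htT (Q i)] with ω h3 h4
    rw [h3, Pi.mul_apply, h4, mul_one]
  filter_upwards [condExp_dotProduct (m := ℱ t) hi, ae_all_iff.2 h1] with ω h2 h3
  rw [h2]
  exact Finset.sum_congr rfl fun i _ => h3 i

/-- Every nonnegative integrable vector is transported from its conditional expectation by some
vector of probability measures. -/
theorem exists_measureVectors_transport_condExp [IsProbabilityMeasure μ] (hT : ℱ T = mΩ)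
    {v : Ω → Fin d → ℝ} (hv : ∀ i, Integrable (fun ω => v ω i) μ) (hv0 : ∀ᵐ ω ∂μ, 0 ≤ v ω) :
    ∃ Q ∈ measureVectors μ d,
      transport ℱ μ t T Q (fun ω i => (μ[fun ω => v ω i | ℱ t]) ω) =ᵐ[μ] v := by
  -- The density of `Q i` is `v_i / E[v_i | ℱ_t]`. Its conditional mean is 1, so `Q i` is a
  -- probability measure whose density at `t` is 1 and whose quotient `ξ` is `r i` itself.
  let r : Fin d → Ω → ℝ := fun i =>
    posQuotient (fun ω => v ω i) (μ[fun ω => v ω i | ℱ t])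
  have hv0' : ∀ i, 0 ≤ᵐ[μ] fun ω => v ω i := fun i => by
    filter_upwards [hv0] with ω hω using hω i
  have hg : ∀ i, Measurable[ℱ t] (μ[fun ω => v ω i | ℱ t]) := fun i =>
    stronglyMeasurable_condExp.measurable
  have hr : ∀ i, Integrable (r i) μ := fun i =>
    integrable_posQuotient (ℱ.le t) (hv i) (hv0' i) (hg i) Filter.EventuallyEq.rfl
  have hr0 : ∀ i, 0 ≤ᵐ[μ] r i := fun i => by
    filter_upwards [hv0' i] with ω hω using posQuotient_nonneg hω
  have hr1 : ∀ i, μ[r i | ℱ t] =ᵐ[μ] fun _ => 1 := fun i =>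
    condExp_posQuotient (ℱ.le t) (hv i) (hv0' i) (hg i) Filter.EventuallyEq.rfl
  let Q : Fin d → Measure Ω := fun i => μ.withDensity fun ω => ENNReal.ofReal (r i ω)
  have hD : ∀ i, (fun ω => ((Q i).rnDeriv μ ω).toReal) =ᵐ[μ] r i := fun i => by
    filter_upwards [Measure.rnDeriv_withDensity₀ μ (hr i).1.aemeasurable.ennreal_ofReal, hr0 i]
      with ω h1 h2
    simp only [Q]
    rw [h1, ENNReal.toReal_ofReal h2]
  have hDt : ∀ i, densityAt ℱ μ t (Q i) =ᵐ[μ] fun _ => 1 := fun i =>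
    (condExp_congr_ae (hD i)).trans (hr1 i)
  have hDT : ∀ i, densityAt ℱ μ T (Q i) =ᵐ[μ] r i := fun i => by
    refine (condExp_congr_ae (hD i)).trans (condExp_of_aestronglyMeasurable' (ℱ.le T) ?_ (hr i))
    rw [hT]
    exact (hr i).1
  have hxi : ∀ i, xi ℱ μ t T (Q i) =ᵐ[μ] r i := fun i => by
    filter_upwards [hDt i, hDT i] with ω h1 h2
    simp only [xi]
    rw [h1, h2, if_pos one_pos, div_one]
  refine ⟨Q, fun i => ⟨⟨?_⟩, withDensity_absolutelyContinuous _ _⟩, ?_⟩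
  · rw [withDensity_apply _ MeasurableSet.univ, Measure.restrict_univ]
    rw [← measure_univ (μ := μ)]
    exact lintegral_ofReal_posQuotient (ℱ.le t) (hv i) (hv0' i) (hg i) Filter.EventuallyEq.rfl
  · have hm : ∀ i, (fun ω => (μ[fun ω => v ω i | ℱ t]) ω * r i ω) =ᵐ[μ] fun ω => v ω i := fun i =>
      mul_posQuotient_ae_eq (ℱ.le t) (hv i) (hv0' i) (hg i) Filter.EventuallyEq.rfl
    filter_upwards [ae_all_iff.2 hxi, ae_all_iff.2 hm] with ω h1 h2
    funext i
    simp only [transport]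
    rw [h1 i]
    exact h2 i

end Transport

/-! ### The space of eligible portfolios -/

section Eligible

variable {Ω : Type*} {m mΩ : MeasurableSpace Ω} {μ : Measure Ω}
  {d : ℕ} {p q : ℝ≥0∞}

theorem single_dotProduct_eq (i : Fin d) (a : ℝ) (z : Fin d → ℝ) :
    (Pi.single i a : Fin d → ℝ) ⬝ᵥ z = a * z i := by
  simp

theorem memLp_single {f : Ω → ℝ} (hf : MemLp f q μ) (i : Fin d) :
    MemLp (fun ω => (Pi.single i (f ω) : Fin d → ℝ)) q μ :=
  (ContinuousLinearMap.single ℝ (fun _ : Fin d => ℝ) i).comp_memLp' hf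

theorem integral_indicator_single_dotProduct {B : Set Ω} (hB : MeasurableSet B) (i : Fin d)
    (Z : Ω → Fin d → ℝ) :
    ∫ ω, (Pi.single i (B.indicator 1 ω) : Fin d → ℝ) ⬝ᵥ Z ω ∂μ = ∫ ω in B, Z ω i ∂μ := by
  rw [← integral_indicator hB]
  refine integral_congr_ae (Filter.Eventually.of_forall fun ω => ?_)
  by_cases hω : ω ∈ B <;> simp [hω]

variable [IsFiniteMeasure μ]

/-- Conditional expectation is self-adjoint: both sides equal `E[E[1_B | m] E[f | m]]`. This moves
the conditioning onto a bounded test function. -/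
theorem integral_condExp_mul_symm (hm : m ≤ mΩ) {f : Ω → ℝ} (hf : Integrable f μ) {B : Set Ω}
    (hB : MeasurableSet B) :
    ∫ ω, (μ[B.indicator 1 | m]) ω * f ω ∂μ = ∫ ω in B, (μ[f | m]) ω ∂μ := by
  have h1i : Integrable (B.indicator (1 : Ω → ℝ)) μ :=
    (integrable_const 1).indicator hB
  have hbound : ∀ᵐ ω ∂μ, ‖(μ[B.indicator (1 : Ω → ℝ) | m]) ω‖ ≤ 1 := by
    have h0 : 0 ≤ᵐ[μ] μ[B.indicator (1 : Ω → ℝ) | m] := condExp_nonneg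
      (Filter.Eventually.of_forall fun ω => indicator_nonneg (fun _ _ => zero_le_one) ω)
    have h1 : μ[B.indicator (1 : Ω → ℝ) | m] ≤ᵐ[μ] μ[fun _ => (1 : ℝ) | m] :=
      condExp_mono h1i (integrable_const 1)
        (Filter.Eventually.of_forall fun ω => indicator_le_self' (fun _ _ => zero_le_one) ω)
    rw [condExp_const hm] at h1
    filter_upwards [h0, h1] with ω h0 h1
    rw [Real.norm_of_nonneg h0]
    exact h1
  have hint1 : Integrable (μ[B.indicator (1 : Ω → ℝ) | m] * f) μ :=
    hf.bdd_mul integrable_condExp.1 hbound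
  have hind : μ[f | m] * B.indicator (1 : Ω → ℝ) = B.indicator (μ[f | m]) := by
    funext ω
    by_cases hω : ω ∈ B <;> simp [hω]
  have hint2 : Integrable (μ[f | m] * B.indicator (1 : Ω → ℝ)) μ := by
    rw [hind]
    exact integrable_condExp.indicator hB
  have e1 := condExp_mul_of_aestronglyMeasurable_left (m := m)
    stronglyMeasurable_condExp.aestronglyMeasurable hint1 hf
  have e2 := condExp_mul_of_aestronglyMeasurable_left (m := m)
    stronglyMeasurable_condExp.aestronglyMeasurable hint2 h1i
  calc ∫ ω, (μ[B.indicator 1 | m]) ω * f ω ∂μ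
      = ∫ ω, (μ[μ[B.indicator (1 : Ω → ℝ) | m] * f | m]) ω ∂μ := (integral_condExp hm).symm
    _ = ∫ ω, (μ[μ[f | m] * B.indicator (1 : Ω → ℝ) | m]) ω ∂μ := by
        refine integral_congr_ae ?_
        filter_upwards [e1, e2] with ω h1 h2
        rw [h1, h2, Pi.mul_apply, Pi.mul_apply, mul_comm]
    _ = ∫ ω, (μ[f | m] * B.indicator (1 : Ω → ℝ)) ω ∂μ := integral_condExp hm
    _ = ∫ ω in B, (μ[f | m]) ω ∂μ := by rw [hind, integral_indicator hB]

theorem memLp_indicator_single {B : Set Ω} (hB : MeasurableSet B) (i : Fin d) :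
    MemLp (fun ω => (Pi.single i (B.indicator 1 ω) : Fin d → ℝ)) q μ :=
  memLp_single (memLp_indicator_const q hB 1 (Or.inr (measure_ne_top μ B))) i

/-- Eligibility as a system of linear equations: `u_i = 0` for `i ≥ k` and `u_i = E[u_i | m]` for
all `i`, both tested against indicators. The test vectors lie in `L^q`, so each equation is closed
for the norm and for the weak* topology, as `isClosed_eligible` requires. -/
theorem mem_eligible_iff [Fact (1 ≤ p)] (hm : m ≤ mΩ) {k : ℕ} {u : Lp (Fin d → ℝ) p μ} :
    u ∈ eligible m p μ (eligibleSpace d k) ↔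
      (∀ i : Fin d, ∀ B, MeasurableSet B → k ≤ (i : ℕ) →
        ∫ ω, (Pi.single i (B.indicator 1 ω) : Fin d → ℝ) ⬝ᵥ u ω ∂μ = 0) ∧
      (∀ i : Fin d, ∀ B, MeasurableSet B →
        ∫ ω, (Pi.single i (B.indicator 1 ω) : Fin d → ℝ) ⬝ᵥ u ω ∂μ =
        ∫ ω, (Pi.single i ((μ[B.indicator 1 | m]) ω) : Fin d → ℝ) ⬝ᵥ u ω ∂μ) := by
  have hui : ∀ i, Integrable (fun ω => u ω i) μ := fun i =>
    ((Lp.memLp u).eval i).integrable Fact.out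
  constructor
  · rintro ⟨hum, huM⟩
    refine ⟨fun i B hB hi => ?_, fun i B hB => ?_⟩
    · rw [integral_indicator_single_dotProduct hB]
      refine setIntegral_eq_zero_of_ae_eq_zero ?_
      filter_upwards [huM] with ω hω _ using hω i hi
    · rw [integral_indicator_single_dotProduct hB]
      simp_rw [single_dotProduct_eq]
      rw [integral_condExp_mul_symm hm (hui i) hB]
      refine integral_congr_ae (ae_restrict_of_ae ?_)
      exact (condExp_of_aestronglyMeasurable' hm (aestronglyMeasurable_coord hum i) (hui i)).symm
  · rintro ⟨h0, h1⟩
    have hcoord : ∀ i, (fun ω => u ω i) =ᵐ[μ] μ[fun ω => u ω i | m] := by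
      intro i
      refine Integrable.ae_eq_of_forall_setIntegral_eq _ _ (hui i) integrable_condExp ?_
      intro B hB _
      have := h1 i B hB
      rw [integral_indicator_single_dotProduct hB] at this
      simp_rw [single_dotProduct_eq] at this
      rw [this, integral_condExp_mul_symm hm (hui i) hB]
    have hmeas : Measurable[m] fun ω i => (μ[fun ω => u ω i | m]) ω :=
      @measurable_pi_lambda _ _ _ m _ _ fun i => stronglyMeasurable_condExp.measurable
    refine ⟨⟨_, hmeas.stronglyMeasurable, ?_⟩, ?_⟩
    · filter_upwards [ae_all_iff.2 hcoord] with ω hω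
      funext i
      exact hω i
    · have hz : ∀ i : Fin d, ∀ᵐ ω ∂μ, k ≤ (i : ℕ) → u ω i = 0 := by
        intro i
        by_cases hi : k ≤ (i : ℕ)
        · have : (fun ω => u ω i) =ᵐ[μ] fun _ => 0 := by
            refine Integrable.ae_eq_of_forall_setIntegral_eq _ _ (hui i) (integrable_zero _ _ _) ?_
            intro B hB _
            rw [← integral_indicator_single_dotProduct hB i, h0 i B hB hi]
            simp
          filter_upwards [this] with ω hω _ using hω
        · exact Filter.Eventually.of_forall fun ω h => absurd h hi
      filter_upwards [ae_all_iff.2 hz] with ω hω i hi using hω i hi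

theorem isClosed_eligible [Fact (1 ≤ p)] [ENNReal.HolderConjugate p q] (hm : m ≤ mΩ) (k : ℕ) :
    @IsClosed _ (lpTopology p μ) (eligible m p μ (eligibleSpace d k)) := by
  have hbm : ∀ B : Set Ω, MeasurableSet B → MemLp (μ[B.indicator (1 : Ω → ℝ) | m]) q μ := by
    intro B hB
    exact MemLp.condExp (ENNReal.HolderConjugate.one_le q p)
      (memLp_indicator_const q hB 1 (Or.inr (measure_ne_top μ B)))
  have heq : eligible m p μ (eligibleSpace d k) =
      (⋂ (i : Fin d) (B : Set Ω) (_ : MeasurableSet B) (_ : k ≤ (i : ℕ)),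
        {u : Lp (Fin d → ℝ) p μ |
          ∫ ω, (Pi.single i (B.indicator 1 ω) : Fin d → ℝ) ⬝ᵥ u ω ∂μ = 0}) ∩
      ⋂ (i : Fin d) (B : Set Ω) (_ : MeasurableSet B), {u : Lp (Fin d → ℝ) p μ |
        ∫ ω, (Pi.single i (B.indicator 1 ω) : Fin d → ℝ) ⬝ᵥ u ω ∂μ =
        ∫ ω, (Pi.single i ((μ[B.indicator 1 | m]) ω) : Fin d → ℝ) ⬝ᵥ u ω ∂μ} := by
    ext u
    rw [mem_eligible_iff hm]
    simp only [mem_inter_iff, mem_iInter, mem_ofPred_eq]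
  rw [heq]
  let _ := lpTopology (d := d) p μ
  refine IsClosed.inter ?_ ?_
  · refine isClosed_iInter fun i => isClosed_iInter fun B => isClosed_iInter fun hB =>
      isClosed_iInter fun _ => ?_
    exact isClosed_eq (continuous_lpTopology_integral (q := q) (memLp_indicator_single hB i))
      continuous_const
  · refine isClosed_iInter fun i => isClosed_iInter fun B => isClosed_iInter fun hB => ?_
    exact isClosed_eq (continuous_lpTopology_integral (q := q) (memLp_indicator_single hB i))
      (continuous_lpTopology_integral (q := q) (memLp_single (hbm B hB) i))

end Eligible

/-! ### Coherent conditional risk measures -/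

section Coherent

variable {Ω : Type*} {m mΩ : MeasurableSpace Ω} {μ : Measure Ω} {d : ℕ} {p q : ℝ≥0∞}
  {R : Lp (Fin d → ℝ) p μ → Set (Lp (Fin d → ℝ) p μ)}

theorem const_smul_eq_smul [IsFiniteMeasure μ] (c : ℝ) (X : Lp (Fin d → ℝ) p μ) :
    (Lp.const ∞ μ c : Lp ℝ ∞ μ) • X = c • X := by
  ext1
  filter_upwards [Lp.coeFn_lpSMul (r := p) (Lp.const ∞ μ c : Lp ℝ ∞ μ) X,
    Lp.coeFn_const (p := ∞) (μ := μ) c, Lp.coeFn_smul c X] with ω h1 h2 h3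
  rw [h1, h3, Pi.smul_apply', Pi.smul_apply, h2, Function.const_apply]

theorem const_mem_LpIn [IsFiniteMeasure μ] {c : ℝ} {D : Set ℝ} (hc : c ∈ D) :
    Lp.const ∞ μ c ∈ LpIn m ∞ μ (fun _ => D) := by
  have h := Lp.coeFn_const (p := ∞) (μ := μ) c
  refine ⟨⟨fun _ => c, stronglyMeasurable_const, h⟩, ?_⟩
  filter_upwards [h] with ω hω
  rw [hω]
  exact hc

theorem add_mem_eligible {M : Submodule ℝ (Fin d → ℝ)} {u v : Lp (Fin d → ℝ) p μ}
    (hu : u ∈ eligible m p μ M) (hv : v ∈ eligible m p μ M) : u + v ∈ eligible m p μ M := by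
  refine ⟨(hu.1.add hv.1).congr (Lp.coeFn_add u v).symm, ?_⟩
  filter_upwards [hu.2, hv.2, Lp.coeFn_add u v] with ω h1 h2 h3
  rw [h3]
  exact M.add_mem h1 h2

theorem smul_mem_eligible {M : Submodule ℝ (Fin d → ℝ)} (c : ℝ) {u : Lp (Fin d → ℝ) p μ}
    (hu : u ∈ eligible m p μ M) : c • u ∈ eligible m p μ M := by
  refine ⟨(hu.1.const_smul c).congr (Lp.coeFn_smul c u).symm, ?_⟩
  filter_upwards [hu.2, Lp.coeFn_smul c u] with ω h1 h3
  rw [h3]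
  exact M.smul_mem c h1

theorem eligiblePos_subset_eligible (M : Submodule ℝ (Fin d → ℝ)) :
    eligiblePos m p μ M ⊆ eligible m p μ M := fun _ hu =>
  ⟨hu.1, hu.2.mono fun _ h => h.1⟩

theorem zero_mem_eligiblePos (M : Submodule ℝ (Fin d → ℝ)) :
    (0 : Lp (Fin d → ℝ) p μ) ∈ eligiblePos m p μ M := by
  have h := Lp.coeFn_zero (Fin d → ℝ) p μ
  refine ⟨⟨fun _ => 0, stronglyMeasurable_const, h⟩, ?_⟩
  filter_upwards [h] with ω hω
  rw [hω]
  exact ⟨M.zero_mem, le_rfl⟩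

theorem IsCondPosHomogeneous.smul_mem [IsFiniteMeasure μ] (h : IsCondPosHomogeneous m p μ R) {c : ℝ} (hc : 0 < c)
    {X u : Lp (Fin d → ℝ) p μ} (hu : u ∈ R X) : c • u ∈ R (c • X) := by
  have := h X (Lp.const ∞ μ c) (const_mem_LpIn hc) (mem_image_of_mem _ hu)
  simpa only [const_smul_eq_smul] using this

theorem IsCondConvex.add_mem [IsFiniteMeasure μ] (h : IsCondConvex m p μ R) {a b : ℝ} (ha : 0 ≤ a) (hb : 0 ≤ b)
    (hab : a + b = 1) {X Y u u' : Lp (Fin d → ℝ) p μ} (hu : u ∈ R X) (hu' : u' ∈ R Y) :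
    a • u + b • u' ∈ R (a • X + b • Y) := by
  have hsub : Lp.const ∞ μ (1 : ℝ) - Lp.const ∞ μ a = Lp.const ∞ μ b := by
    rw [← map_sub, ← hab, add_sub_cancel_left]
  have := h X Y (Lp.const ∞ μ a) (const_mem_LpIn ⟨ha, by linarith⟩)
    (add_mem_add (mem_image_of_mem _ hu) (mem_image_of_mem _ hu'))
  rw [hsub] at this
  simpa only [const_smul_eq_smul] using this

/-- Acceptable positions have nonnegative conditional prices under acceptable functionals. -/
theorem condExp_dotProduct_nonneg_of_mem_lpDualCone [IsFiniteMeasure μ] (hm : m ≤ mΩ)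
    [ENNReal.HolderConjugate p q]
    (hcoh : IsCondPosHomogeneous m p μ R) {v : Ω → Fin d → ℝ}
    (hv : v ∈ lpDualCone p μ q (acceptanceSet p μ R)) {Z : Lp (Fin d → ℝ) p μ}
    (hZ : Z ∈ acceptanceSet p μ R) : 0 ≤ᵐ[μ] μ[fun ω => v ω ⬝ᵥ Z ω | m] := by
  classical
  have hi : Integrable (fun ω => v ω ⬝ᵥ Z ω) μ := integrable_dotProduct hv.1 (Lp.memLp Z)
  have hset : ∀ D, MeasurableSet[m] D → 0 ≤ ∫ ω in D, v ω ⬝ᵥ Z ω ∂μ := by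
    intro D hD
    -- Homogeneity admits only strictly positive multipliers, so `1_D` is replaced by `1_D + ε
    -- 1_{Dᶜ}` and `ε` tends to 0 afterwards.
    have hε : ∀ ε : ℝ, 0 < ε →
        0 ≤ ∫ ω in D, v ω ⬝ᵥ Z ω ∂μ + ε * ∫ ω in Dᶜ, v ω ⬝ᵥ Z ω ∂μ := by
      intro ε hε
      let g : Ω → ℝ := D.piecewise (fun _ => 1) (fun _ => ε)
      have hg : Measurable[m] g := Measurable.piecewise hD measurable_const measurable_const
      have hgL : MemLp g ∞ μ := by
        refine memLp_top_of_bound (hg.mono hm le_rfl).aestronglyMeasurable (max 1 ε)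
          (Filter.Eventually.of_forall fun ω => ?_)
        by_cases hω : ω ∈ D
        · simp [g, hω]
        · simp [g, hω, abs_of_pos hε]
      have hmem : hgL.toLp g ∈ LpIn m ∞ μ (fun _ => Ioi (0 : ℝ)) := by
        refine ⟨⟨g, hg.stronglyMeasurable, hgL.coeFn_toLp⟩, ?_⟩
        filter_upwards [hgL.coeFn_toLp] with ω hω
        rw [hω]
        by_cases hω : ω ∈ D <;> simp [g, hω, hε]
      have h1 := hcoh Z _ hmem (mem_image_of_mem _ hZ)
      have hz : (hgL.toLp g : Lp ℝ ∞ μ) • (0 : Lp (Fin d → ℝ) p μ) = 0 := Lp.smul_zero (E := Fin d → ℝ) p _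
      simp only [hz] at h1
      have h2 := hv.2 _ h1
      have h3 : ∫ ω, v ω ⬝ᵥ ((hgL.toLp g : Lp ℝ ∞ μ) • Z : Lp (Fin d → ℝ) p μ) ω ∂μ =
          ∫ ω, g ω * (v ω ⬝ᵥ Z ω) ∂μ := by
        refine integral_congr_ae ?_
        filter_upwards [Lp.coeFn_lpSMul (r := p) (hgL.toLp g : Lp ℝ ∞ μ) Z, hgL.coeFn_toLp]
          with ω h1 h2
        rw [h1, Pi.smul_apply', h2, dotProduct_smul, smul_eq_mul]
      have hgi : Integrable (fun ω => g ω * (v ω ⬝ᵥ Z ω)) μ :=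
        hi.bdd_mul hgL.1 (c := max 1 ε) (Filter.Eventually.of_forall fun ω => by
          by_cases hω : ω ∈ D
          · simp [g, hω]
          · simp [g, hω, abs_of_pos hε])
      rw [h3, ← integral_add_compl (hm D hD) hgi] at h2
      have h4 : ∫ ω in D, g ω * (v ω ⬝ᵥ Z ω) ∂μ = ∫ ω in D, v ω ⬝ᵥ Z ω ∂μ :=
        setIntegral_congr_fun (hm D hD) fun ω hω => by simp [g, hω]
      have h5 : ∫ ω in Dᶜ, g ω * (v ω ⬝ᵥ Z ω) ∂μ = ε * ∫ ω in Dᶜ, v ω ⬝ᵥ Z ω ∂μ := by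
        rw [← integral_const_mul]
        refine setIntegral_congr_fun (hm D hD).compl fun ω hω => ?_
        have hω' : ω ∉ D := hω
        simp [g, hω']
      rwa [h4, h5] at h2
    have hlim : Filter.Tendsto
        (fun ε : ℝ => ∫ ω in D, v ω ⬝ᵥ Z ω ∂μ + ε * ∫ ω in Dᶜ, v ω ⬝ᵥ Z ω ∂μ)
        (nhdsWithin 0 (Ioi 0)) (nhds (∫ ω in D, v ω ⬝ᵥ Z ω ∂μ)) := by
      refine (Continuous.tendsto' ?_ 0 _ (by simp)).mono_left nhdsWithin_le_nhds
      fun_prop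
    exact ge_of_tendsto hlim (eventually_mem_nhdsWithin.mono fun ε h => hε ε h)
  set f := μ[fun ω => v ω ⬝ᵥ Z ω | m] with hf
  have hfm : Measurable[m] f := stronglyMeasurable_condExp.measurable
  have hD : MeasurableSet[m] {ω | f ω < 0} :=
    @measurableSet_lt _ _ _ _ _ m _ _ _ _ _ hfm measurable_const
  have h1 := hset _ hD
  rw [← setIntegral_condExp hm hi hD, ← hf] at h1
  have h2 : 0 ≤ᵐ[μ.restrict {ω | f ω < 0}] fun ω => - f ω := by
    filter_upwards [ae_restrict_mem (hm _ hD)] with ω hω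
    exact (neg_pos.2 hω).le
  have h3 : ∫ ω in {ω | f ω < 0}, - f ω ∂μ = 0 := by
    refine le_antisymm ?_ (integral_nonneg_of_ae h2)
    rw [integral_neg]
    linarith
  rw [setIntegral_eq_zero_iff_of_nonneg_ae h2 integrable_condExp.neg.integrableOn,
    Filter.EventuallyEq, ae_restrict_iff' (hm _ hD)] at h3
  filter_upwards [h3] with ω hω
  by_contra hneg
  have hlt : f ω < 0 := not_le.1 hneg
  have := hω hlt
  simp only [Pi.zero_apply, neg_eq_zero] at this
  exact hlt.ne this

variable {M : Submodule ℝ (Fin d → ℝ)} [Fact (1 ≤ p)]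

theorem IsConditionalRiskMeasure.sub_mem (hR : IsConditionalRiskMeasure m p μ M R)
    {X u c : Lp (Fin d → ℝ) p μ} (hu : u ∈ R X) (hc : c ∈ eligible m p μ M) :
    u - c ∈ R (X + c) := by
  rw [hR.translative X c hc]
  exact mem_image_of_mem _ hu

theorem IsConditionalRiskMeasure.add_mem_acceptanceSet (hR : IsConditionalRiskMeasure m p μ M R)
    {X u : Lp (Fin d → ℝ) p μ} (hu : u ∈ R X) : X + u ∈ acceptanceSet p μ R := by
  have := hR.sub_mem hu (hR.subset_eligible X hu)
  rwa [sub_self] at this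

theorem IsConditionalRiskMeasure.zero_mem_of_nonneg (hR : IsConditionalRiskMeasure m p μ M R)
    (h0 : 0 ∈ R 0) {Z : Lp (Fin d → ℝ) p μ} (hZ : ∀ᵐ ω ∂μ, 0 ≤ Z ω) : 0 ∈ R Z :=
  hR.monotone 0 Z (by rwa [sub_zero]) h0

theorem IsConditionalRiskMeasure.eligiblePos_subset (hR : IsConditionalRiskMeasure m p μ M R)
    (h0 : 0 ∈ R 0) : eligiblePos m p μ M ⊆ R 0 := by
  intro u hu
  rw [hR.upper 0]
  exact ⟨0, h0, u, hu, zero_add u⟩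

variable [IsFiniteMeasure μ]

/-- `R 0` is a nonempty closed cone: shrink any element to 0. -/
theorem IsConditionalRiskMeasure.zero_mem (hR : IsConditionalRiskMeasure m p μ M R)
    (hcoh : IsCondPosHomogeneous m p μ R) : 0 ∈ R 0 := by
  obtain ⟨u, hu⟩ := hR.zero_nonempty
  have hlim : Filter.Tendsto (fun n : ℕ => (1 / ((n : ℝ) + 1)) • u) Filter.atTop (nhds 0) := by
    simpa using (tendsto_one_div_add_atTop_nhds_zero_nat (𝕜 := ℝ)).smul_const u
  refine (isClosed_of_isClosed_lpTopology hR.zero_closed).mem_of_tendsto hlim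
    (Filter.Eventually.of_forall fun n => ?_)
  have := hcoh.smul_mem (c := 1 / ((n : ℝ) + 1)) (by positivity) hu
  rwa [smul_zero] at this

end Coherent

/-! ### Separation of positions from acceptance sets -/

section Dual

variable {Ω : Type*} {m mΩ : MeasurableSpace Ω} {μ : Measure Ω}
  {d k : ℕ} {p q : ℝ≥0∞} [Fact (1 ≤ p)]
  {R : Lp (Fin d → ℝ) p μ → Set (Lp (Fin d → ℝ) p μ)}

/-- The set of positions with a risk compensating portfolio of nonpositive price is closed. -/
theorem isClosed_exists_integral_nonpos [IsFiniteMeasure μ] [ENNReal.HolderConjugate p q]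
    (hm : m ≤ mΩ) (hcuc : IsConvexUpperContinuous m p μ (eligibleSpace d k) R)
    {w : Ω → Fin d → ℝ} (hw : MemLp w q μ)
    (hpos : ∀ u ∈ eligiblePos m p μ (eligibleSpace d k), 0 ≤ ∫ ω, w ω ⬝ᵥ u ω ∂μ) :
    @IsClosed _ (lpTopology p μ) {Z | ∃ u ∈ R Z, u ∈ eligible m p μ (eligibleSpace d k) ∧
      ∫ ω, w ω ⬝ᵥ u ω ∂μ ≤ 0} := by
  obtain ⟨ψ, hψ⟩ := exists_continuousLinearMap_eq_integral (p := p) hw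
  -- A closed half-space of `M_t`. It absorbs `M_{t,-}` because `w` prices `M_{t,+}` nonnegatively,
  -- so it is an admissible test set for convex upper continuity.
  let D : Set (Lp (Fin d → ℝ) p μ) :=
    {u | u ∈ eligible m p μ (eligibleSpace d k) ∧ ∫ ω, w ω ⬝ᵥ u ω ∂μ ≤ 0}
  have hadd : D + eligibleNeg m p μ (eligibleSpace d k) = D := by
    refine Subset.antisymm ?_ fun u hu => ⟨u, hu, 0, ?_, add_zero u⟩
    · rintro _ ⟨u, hu, n, hn, rfl⟩
      have hn' : -n ∈ eligiblePos m p μ (eligibleSpace d k) := hn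
      have hnM := smul_mem_eligible (-1 : ℝ) (eligiblePos_subset_eligible _ hn')
      rw [neg_smul, one_smul, neg_neg] at hnM
      refine ⟨add_mem_eligible hu.1 hnM, ?_⟩
      have h1 := hpos _ hn'
      have h2 := hu.2
      rw [← hψ] at h1 h2 ⊢
      rw [map_neg] at h1
      rw [map_add]
      linarith
    · change -0 ∈ eligiblePos m p μ (eligibleSpace d k)
      rw [neg_zero]
      exact zero_mem_eligiblePos _
  have hconv : Convex ℝ D := by
    intro u hu u' hu' a b ha hb hab
    refine ⟨add_mem_eligible (smul_mem_eligible a hu.1) (smul_mem_eligible b hu'.1), ?_⟩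
    have h1 := hu.2
    have h2 := hu'.2
    rw [← hψ] at h1 h2 ⊢
    rw [map_add, map_smul, map_smul, smul_eq_mul, smul_eq_mul]
    exact add_nonpos (mul_nonpos_of_nonneg_of_nonpos ha h1)
      (mul_nonpos_of_nonneg_of_nonpos hb h2)
  have hclosed : @IsClosed _ (lpTopology p μ) D := by
    let _ := lpTopology (d := d) p μ
    exact (isClosed_eligible (q := q) hm k).inter
      (isClosed_le (continuous_lpTopology_integral hw) continuous_const)
  have h := hcuc D (fun u hu => hu.1) (by
    rw [hadd, hconv.convexHull_eq]
    exact (@IsClosed.closure_eq _ (lpTopology p μ) _ hclosed).symm)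
  exact h

theorem exists_memLp_lt_neg_integral [IsFiniteMeasure μ] [ENNReal.HolderConjugate p q]
    (hm : m ≤ mΩ) (hR : IsConditionalRiskMeasure m p μ (eligibleSpace d k) R)
    (hcuc : IsConvexUpperContinuous m p μ (eligibleSpace d k) R)
    (hcoh : IsCondCoherent m p μ R) {w : Ω → Fin d → ℝ} (hw : MemLp w q μ)
    (hpos : ∀ u ∈ eligiblePos m p μ (eligibleSpace d k), 0 ≤ ∫ ω, w ω ⬝ᵥ u ω ∂μ)
    {e : Lp (Fin d → ℝ) p μ} (he : e ∈ eligible m p μ (eligibleSpace d k))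
    (hwe : 0 < ∫ ω, w ω ⬝ᵥ e ω ∂μ) {X : Lp (Fin d → ℝ) p μ} (hX : (R X).Nonempty) {a : ℝ}
    (ha : ∀ u ∈ R X, a < ∫ ω, w ω ⬝ᵥ u ω ∂μ) :
    ∃ v : Ω → Fin d → ℝ, v ∈ lpDualCone p μ q (acceptanceSet p μ R) ∧ (∀ᵐ ω ∂μ, 0 ≤ v ω) ∧
      (∀ u ∈ eligible m p μ (eligibleSpace d k), ∫ ω, v ω ⬝ᵥ u ω ∂μ = ∫ ω, w ω ⬝ᵥ u ω ∂μ) ∧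
      a < - ∫ ω, v ω ⬝ᵥ X ω ∂μ := by
  have h0 := hR.zero_mem hcoh.2
  obtain ⟨ψ, hψ⟩ := exists_continuousLinearMap_eq_integral (p := p) hw
  have hclosed := isClosed_exists_integral_nonpos hm hcuc hw hpos
  simp_rw [← hψ] at hclosed hwe ha ⊢
  set B : Set (Lp (Fin d → ℝ) p μ) :=
    {Z | ∃ u ∈ R Z, u ∈ eligible m p μ (eligibleSpace d k) ∧ ψ u ≤ 0} with hB
  have hacc : acceptanceSet p μ R ⊆ B := fun Z hZ =>
    ⟨0, hZ, hR.subset_eligible _ hZ, (map_zero ψ).le⟩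
  have hnonneg : ∀ Z : Lp (Fin d → ℝ) p μ, (∀ᵐ ω ∂μ, 0 ≤ Z ω) → Z ∈ B := fun Z hZ =>
    hacc (hR.zero_mem_of_nonneg h0 hZ)
  have hsmul : ∀ c : ℝ, 0 < c → ∀ Z ∈ B, c • Z ∈ B := by
    rintro c hc Z ⟨u, hu, huM, hu0⟩
    refine ⟨c • u, hcoh.2.smul_mem hc hu, smul_mem_eligible c huM, ?_⟩
    rw [map_smul, smul_eq_mul]
    exact mul_nonpos_of_nonneg_of_nonpos hc.le hu0
  have hconv : Convex ℝ B := by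
    rintro Z ⟨u, hu, huM, hu0⟩ Z' ⟨u', hu', huM', hu0'⟩ s t hs ht hst
    refine ⟨s • u + t • u', hcoh.1.add_mem hs ht hst hu hu',
      add_mem_eligible (smul_mem_eligible s huM) (smul_mem_eligible t huM'), ?_⟩
    rw [map_add, map_smul, map_smul, smul_eq_mul, smul_eq_mul]
    exact add_nonpos (mul_nonpos_of_nonneg_of_nonpos hs hu0)
      (mul_nonpos_of_nonneg_of_nonpos ht hu0')
  have hshift : ∀ Z u s, u ∈ R Z → ψ u ≤ s * ψ e → Z + s • e ∈ B := by
    intro Z u s hu hs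
    have hmem := hR.sub_mem hu (smul_mem_eligible s he)
    refine ⟨u - s • e, hmem, hR.subset_eligible _ hmem, ?_⟩
    rw [map_sub, map_smul, smul_eq_mul]
    linarith
  have helig : ∀ u ∈ eligible m p μ (eligibleSpace d k), 0 ≤ ψ u → u ∈ B := by
    intro u hu hu0
    have hmem := hR.sub_mem h0 hu
    rw [zero_sub, zero_add] at hmem
    exact ⟨-u, hmem, hR.subset_eligible _ hmem, by rw [map_neg]; linarith⟩
  -- A portfolio of price at most 0 compensating the shifted position would give one in `R X` of
  -- price at most `a`.
  have hz : X + (a / ψ e) • e ∉ B := by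
    rintro ⟨u, hu, huM, hu0⟩
    rw [hR.translative X _ (smul_mem_eligible _ he)] at hu
    obtain ⟨u', hu', rfl⟩ := hu
    have := ha u' hu'
    simp only [map_sub, map_smul, smul_eq_mul, div_mul_cancel₀ _ hwe.ne'] at hu0
    linarith
  obtain ⟨y, hy, hyB, hyz⟩ := exists_memLp_of_notMem_cone (q := q) hconv hclosed hnonneg hsmul hz
  obtain ⟨φ, hφ⟩ := exists_continuousLinearMap_eq_integral (p := p) hy
  simp_rw [← hφ] at hyB hyz
  -- For `u ∈ R X`, the point `X + (ψ u / ψ e) • e` lies in `B`, so `φ` is nonnegative there but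
  -- negative at the smaller multiple `a / ψ e`: `φ` increases along `e`.
  have hφe : 0 < φ e := by
    obtain ⟨u, hu⟩ := hX
    have h1 := hyB _ (hshift X u (ψ u / ψ e) hu (div_mul_cancel₀ _ hwe.ne').ge)
    have hlt : a / ψ e < ψ u / ψ e := div_lt_div_of_pos_right (ha u hu) hwe
    rw [map_add, map_smul, smul_eq_mul] at h1 hyz
    nlinarith
  -- If `ψ u = 0`, both `u` and `-u` lie in `B`. Hence `φ` is a multiple of `ψ` on `M_t`, and the
  -- factor `r` below normalises it to `ψ`.
  have hker : ∀ u ∈ eligible m p μ (eligibleSpace d k), ψ u = 0 → φ u = 0 := by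
    intro u hu hu0
    refine le_antisymm ?_ (hyB u (helig u hu hu0.ge))
    have := hyB _ (helig _ (smul_mem_eligible (-1) hu) (by rw [map_smul, hu0, smul_zero]))
    rw [map_smul, smul_eq_mul] at this
    linarith
  have hφψ : ∀ u ∈ eligible m p μ (eligibleSpace d k), ψ e / φ e * φ u = ψ u := by
    intro u hu
    have h1 := hker (u + (-(ψ u / ψ e)) • e)
      (add_mem_eligible hu (smul_mem_eligible _ he)) (by
        rw [map_add, map_smul, smul_eq_mul, neg_mul, div_mul_cancel₀ _ hwe.ne', add_neg_cancel])
    rw [map_add, map_smul, smul_eq_mul] at h1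
    have h2 : φ u = ψ u / ψ e * φ e := by linarith
    rw [h2]
    field_simp
  have hr : 0 < ψ e / φ e := div_pos hwe hφe
  set r := ψ e / φ e with hrdef
  have hvint : ∀ Z : Lp (Fin d → ℝ) p μ, ∫ ω, (r • y) ω ⬝ᵥ Z ω ∂μ = r * φ Z := by
    intro Z
    rw [hφ, ← integral_const_mul]
    simp [smul_dotProduct]
  have hvB : ∀ Z ∈ B, 0 ≤ ∫ ω, (r • y) ω ⬝ᵥ Z ω ∂μ := fun Z hZ => by
    rw [hvint]
    exact mul_nonneg hr.le (hyB Z hZ)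
  have hvL : MemLp (r • y) q μ := hy.const_smul r
  refine ⟨r • y, ⟨hvL, fun Z hZ => hvB Z (hacc hZ)⟩, ?_, fun u hu => ?_, ?_⟩
  · have hcoord : ∀ i, ∀ᵐ ω ∂μ, 0 ≤ (r • y) ω i := by
      intro i
      refine ae_nonneg_of_forall_setIntegral_nonneg
        ((hvL.eval i).integrable (ENNReal.HolderConjugate.one_le q p)) fun s hs _ => ?_
      have hsp : MemLp (fun ω => (Pi.single i (s.indicator 1 ω) : Fin d → ℝ)) p μ :=
        memLp_indicator_single hs i
      have h1 := hvB hsp.toLp (hnonneg _ (by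
        filter_upwards [hsp.coeFn_toLp] with ω hω
        rw [hω]
        exact Pi.single_nonneg.2 (indicator_nonneg (fun _ _ => zero_le_one) ω)))
      rw [← integral_indicator_single_dotProduct hs]
      refine h1.trans_eq (integral_congr_ae ?_)
      filter_upwards [hsp.coeFn_toLp] with ω hω
      rw [hω, dotProduct_comm]
    filter_upwards [ae_all_iff.2 hcoord] with ω hω using hω
  · rw [hvint, hφψ u hu]
  · rw [hvint]
    rw [map_add, map_smul, smul_eq_mul] at hyz
    have h1 : r * (φ X + a / ψ e * φ e) < 0 := mul_neg_of_pos_of_neg hr hyz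
    have h2 : r * (φ X + a / ψ e * φ e) = r * φ X + a := by
      rw [hrdef]
      field_simp
    linarith

end Dual

/-! ### Dual representation of the scalarizations -/

section EssSup

variable {Ω : Type*} {m mΩ : MeasurableSpace Ω} {P : Measure Ω}

/-- A family of random variables below an integrable `Y` whose expectations come arbitrarily close
to that of `Y` has `Y` as its essential supremum. -/
theorem IsFamEssSup.ae_eq_of_integral {κ : Type*} (hm : m ≤ mΩ)
    {f : κ → Ω → ℝ} {V : Ω → EReal} (hV : IsFamEssSup m P (fun i ω => (f i ω : EReal)) V)
    {Y : Ω → ℝ} (hY : Integrable Y P) (hVY : V ≤ᵐ[P] fun ω => (Y ω : EReal))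
    (hex : ∀ a < ∫ ω, Y ω ∂P, ∃ i, Integrable (f i) P ∧ a < ∫ ω, f i ω ∂P) :
    V =ᵐ[P] fun ω => (Y ω : EReal) := by
  -- Any single integrable member will do: it bounds `V` from below, making `V` real almost
  -- everywhere and integrable.
  obtain ⟨i₀, hi₀, -⟩ := hex (∫ ω, Y ω ∂P - 1) (by linarith)
  have hreal : ∀ᵐ ω ∂P, ((V ω).toReal : EReal) = V ω := by
    filter_upwards [hVY, hV.upper i₀] with ω h1 h2
    exact EReal.coe_toReal (ne_top_of_le_ne_top (EReal.coe_ne_top _) h1)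
      (ne_bot_of_le_ne_bot (EReal.coe_ne_bot _) h2)
  have hle : ∀ i, f i ≤ᵐ[P] fun ω => (V ω).toReal := fun i => by
    filter_upwards [hV.upper i, hreal] with ω h1 h2
    rw [← h2] at h1
    exact EReal.coe_le_coe_iff.1 h1
  have hleY : (fun ω => (V ω).toReal) ≤ᵐ[P] Y := by
    filter_upwards [hVY, hreal] with ω h1 h2
    rw [← h2] at h1
    exact EReal.coe_le_coe_iff.1 h1
  have hVm : AEStronglyMeasurable (fun ω => (V ω).toReal) P :=
    ((hV.measurable.mono hm le_rfl).ereal_toReal).aestronglyMeasurable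
  have hVi : Integrable (fun ω => (V ω).toReal) P := integrable_of_le_of_le hVm (hle i₀) hleY hi₀ hY
  have hint : ∫ ω, Y ω ∂P ≤ ∫ ω, (V ω).toReal ∂P := by
    refine le_of_forall_lt fun a ha => ?_
    obtain ⟨i, hi, hai⟩ := hex a ha
    exact hai.trans_le (integral_mono_ae hi hVi (hle i))
  have heq : (fun ω => (V ω).toReal) =ᵐ[P] Y :=
    (integral_eq_iff_of_ae_le hVi hY hleY).1 (le_antisymm (integral_mono_ae hVi hY hleY) hint)
  filter_upwards [heq, hreal] with ω h1 h2
  rw [← h2, h1]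

end EssSup

/-! ### Weak and strong duality for dual pairs -/

section Representation

variable {Ω : Type*} {mΩ : MeasurableSpace Ω} {P : Measure Ω}
  {ι : Type*} [Preorder ι] {ℱ : Filtration ι mΩ} {t T : ι} {d k : ℕ} {p q : ℝ≥0∞}
  {R : Lp (Fin d → ℝ) p P → Set (Lp (Fin d → ℝ) p P)} {w : Lp (Fin d → ℝ) q P}

theorem dotProduct_eq_of_forall_lt {v w u : Fin d → ℝ} (h : ∀ i : Fin d, (i : ℕ) < k → v i = w i)
    (hu : u ∈ eligibleSpace d k) : v ⬝ᵥ u = w ⬝ᵥ u := by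
  refine Finset.sum_congr rfl fun i _ => ?_
  by_cases hi : (i : ℕ) < k
  · rw [h i hi]
  · rw [hu i (not_lt.1 hi), mul_zero, mul_zero]

/-- The sum of the first `k` unit vectors. -/
def eligibleOnes (d k : ℕ) : Fin d → ℝ := fun i => if (i : ℕ) < k then 1 else 0

theorem eligibleOnes_mem : eligibleOnes d k ∈ posPart (eligibleSpace d k) :=
  ⟨fun i hi => if_neg (not_lt.2 hi), fun i => by
    unfold eligibleOnes
    split_ifs
    exacts [zero_le_one, le_rfl]⟩

theorem dotProduct_eligibleOnes_ne_zero {v : Fin d → ℝ}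
    (hv : ∀ i : Fin d, (i : ℕ) < k → 0 ≤ v i) (hperp : v ∉ perp (eligibleSpace d k)) :
    v ⬝ᵥ eligibleOnes d k ≠ 0 := by
  intro h0
  have hterm : ∀ i : Fin d, 0 ≤ v i * eligibleOnes d k i := by
    intro i
    unfold eligibleOnes
    split_ifs with hi
    · simpa using hv i hi
    · simp
  have h1 := (Finset.sum_eq_zero_iff_of_nonneg fun i _ => hterm i).1 h0
  refine hperp fun u hu => ?_
  rw [dotProduct_eq_of_forall_lt (w := 0) (fun i hi => ?_) hu, zero_dotProduct]
  simpa [eligibleOnes, hi] using h1 i (Finset.mem_univ i)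

theorem const_mem_eligiblePos [IsFiniteMeasure P] {m : MeasurableSpace Ω} {M : Submodule ℝ (Fin d → ℝ)}
    {c : Fin d → ℝ} (hc : c ∈ posPart M) : Lp.const p P c ∈ eligiblePos m p P M := by
  have h := Lp.coeFn_const (p := p) (μ := P) c
  refine ⟨⟨fun _ => c, stronglyMeasurable_const, h⟩, ?_⟩
  filter_upwards [h] with ω hω
  rw [hω]
  exact hc

/-- Testing with the eligible portfolios `1_D e_i`, `D ∈ ℱ_t`, identifies the conditional
expectation. -/
theorem condExp_coord_ae_eq [IsFiniteMeasure P] [ENNReal.HolderConjugate p q]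
    (hw : AEStronglyMeasurable[ℱ t] w P) {v : Ω → Fin d → ℝ}
    (hv : MemLp v q P)
    (hvw : ∀ u ∈ eligible (ℱ t) p P (eligibleSpace d k),
      ∫ ω, v ω ⬝ᵥ u ω ∂P = ∫ ω, w ω ⬝ᵥ u ω ∂P) {i : Fin d} (hi : (i : ℕ) < k) :
    P[fun ω => v ω i | ℱ t] =ᵐ[P] fun ω => w ω i := by
  have hq : 1 ≤ q := ENNReal.HolderConjugate.one_le q p
  have hvi : Integrable (fun ω => v ω i) P := (hv.eval i).integrable hq
  have hwi : Integrable (fun ω => w ω i) P := ((Lp.memLp w).eval i).integrable hq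
  refine (ae_eq_condExp_of_forall_setIntegral_eq (ℱ.le t) hvi (fun s _ _ => hwi.integrableOn)
    (fun D hD _ => ?_) (aestronglyMeasurable_coord hw i)).symm
  have hD' := ℱ.le t D hD
  have hu : MemLp (fun ω => (Pi.single i (D.indicator 1 ω) : Fin d → ℝ)) p P :=
    memLp_indicator_single hD' i
  have hmem : hu.toLp ∈ eligible (ℱ t) p P (eligibleSpace d k) := by
    refine ⟨⟨_, ?_, hu.coeFn_toLp⟩, ?_⟩
    · exact (ContinuousLinearMap.single ℝ (fun _ : Fin d => ℝ) i).continuous.comp_stronglyMeasurable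
        (stronglyMeasurable_one.indicator hD)
    · filter_upwards [hu.coeFn_toLp] with ω hω
      rw [hω]
      intro j hj
      refine Pi.single_eq_of_ne ?_ _
      rintro rfl
      exact absurd hi (not_lt.2 hj)
  have h1 := hvw _ hmem
  have h2 : ∀ y : Ω → Fin d → ℝ, ∫ ω, y ω ⬝ᵥ (hu.toLp : Lp (Fin d → ℝ) p P) ω ∂P = ∫ ω in D, y ω i ∂P := by
    intro y
    rw [← integral_indicator_single_dotProduct hD' i]
    refine integral_congr_ae ?_
    filter_upwards [hu.coeFn_toLp] with ω hω
    rw [hω, dotProduct_comm]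
  rw [h2, h2] at h1
  exact h1.symm

variable [Fact (1 ≤ p)]

/-- `M_{t,+} ⊆ R 0 = Lᵖ_t(S)`, so membership in the dual cone of `S` applies pointwise to `u`. -/
theorem dotProduct_nonneg_of_mem_dualCone {m : MeasurableSpace Ω} {M : Submodule ℝ (Fin d → ℝ)}
    (hR : IsConditionalRiskMeasure m p P M R) (h0 : 0 ∈ R 0)
    {S : Ω → Set (Fin d → ℝ)} (hS : IsZeroSet m p P R S)
    (hw : ∀ᵐ ω ∂P, w ω ∈ dualCone (S ω)) {u : Lp (Fin d → ℝ) p P}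
    (hu : u ∈ eligiblePos m p P M) : ∀ᵐ ω ∂P, 0 ≤ w ω ⬝ᵥ u ω := by
  have h := hR.eligiblePos_subset h0 hu
  rw [hS.2] at h
  filter_upwards [hw, h.2] with ω h1 h2 using h1 _ h2

variable [ENNReal.HolderConjugate p q]

theorem integrable_transport_dotProduct {x : (Fin d → Measure Ω) × Lp (Fin d → ℝ) q P}
    (hx : x ∈ coherentDualPairs ℱ P (eligibleSpace d k) q t T R w)
    (X : Lp (Fin d → ℝ) p P) :
    Integrable (fun ω => transport ℱ P t T x.1 ⇑(w + x.2) ω ⬝ᵥ X ω) P :=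
  integrable_dotProduct hx.1.2.2.2.2.1 (Lp.memLp X)

variable [IsProbabilityMeasure P]

theorem nonneg_of_mem_coherentDualPairs (htT : t ≤ T)
    {x : (Fin d → Measure Ω) × Lp (Fin d → ℝ) q P}
    (hx : x ∈ coherentDualPairs ℱ P (eligibleSpace d k) q t T R w) :
    ∀ᵐ ω ∂P, 0 ≤ (w + x.2) ω :=
  nonneg_of_transport_nonneg htT (ENNReal.HolderConjugate.one_le q p) hx.1.2.2.2.1.1
    hx.1.2.2.2.2.1 hx.1.2.2.2.2.2

theorem dualValue_ae_eq_condExp (htT : t ≤ T) {x : (Fin d → Measure Ω) × Lp (Fin d → ℝ) q P}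
    (hx : x ∈ coherentDualPairs ℱ P (eligibleSpace d k) q t T R w)
    (X : Lp (Fin d → ℝ) p P) :
    (fun ω => (w + x.2) ω ⬝ᵥ condExpQ ℱ P t T x.1 (-X) ω) =ᵐ[P]
      P[fun ω => - (transport ℱ P t T x.1 ⇑(w + x.2) ω ⬝ᵥ X ω) | ℱ t] := by
  refine (dotProduct_condExpQ_ae_eq htT hx.1.2.2.2.1.1 (nonneg_of_mem_coherentDualPairs htT hx)
    hx.1.2.2.2.2.1 (Lp.memLp X).neg).trans (condExp_congr_ae ?_)
  exact Filter.Eventually.of_forall fun ω => dotProduct_neg _ _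

/-- Weak duality: the dual values are below the prices of the compensating portfolios. -/
theorem dualValue_le_dotProduct (htT : t ≤ T)
    (hR : IsConditionalRiskMeasure (ℱ t) p P (eligibleSpace d k) R)
    (hcoh : IsCondPosHomogeneous (ℱ t) p P R)
    {x : (Fin d → Measure Ω) × Lp (Fin d → ℝ) q P}
    (hx : x ∈ coherentDualPairs ℱ P (eligibleSpace d k) q t T R w)
    {X u : Lp (Fin d → ℝ) p P} (hu : u ∈ R X) :
    (fun ω => (w + x.2) ω ⬝ᵥ condExpQ ℱ P t T x.1 (-X) ω) ≤ᵐ[P] fun ω => w ω ⬝ᵥ u ω := by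
  have huM := hR.subset_eligible X hu
  have h1 := condExp_dotProduct_nonneg_of_mem_lpDualCone (ℱ.le t) hcoh hx.2
    (hR.add_mem_acceptanceSet hu)
  have h2 := condExp_transport_dotProduct_of_measurable htT hx.1.2.2.2.1.1 huM.1
    hx.1.2.2.2.2.1 (Lp.memLp u)
  have h3 := dualValue_ae_eq_condExp htT hx X
  have h4 : P[fun ω => transport ℱ P t T x.1 ⇑(w + x.2) ω ⬝ᵥ (X + u) ω | ℱ t] =ᵐ[P]
      P[fun ω => transport ℱ P t T x.1 ⇑(w + x.2) ω ⬝ᵥ u ω | ℱ t] -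
      P[fun ω => - (transport ℱ P t T x.1 ⇑(w + x.2) ω ⬝ᵥ X ω) | ℱ t] := by
    refine Filter.EventuallyEq.trans (condExp_congr_ae ?_)
      (condExp_sub (integrable_transport_dotProduct hx u)
        (integrable_transport_dotProduct hx X).neg _)
    filter_upwards [Lp.coeFn_add X u] with ω hω
    rw [hω, Pi.add_apply, dotProduct_add]
    simp only [Pi.sub_apply, Pi.neg_apply]
    ring
  filter_upwards [h1, h2, h3, h4, hx.1.2.1.2, huM.2, Lp.coeFn_add w x.2]
    with ω h1 h2 h3 h4 h5 h6 h7
  have h8 : (w + x.2) ω ⬝ᵥ u ω = w ω ⬝ᵥ u ω := by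
    rw [h7, Pi.add_apply, add_dotProduct, h5 _ h6, add_zero]
  rw [h4, Pi.sub_apply, h2, h8, ← h3] at h1
  exact sub_nonneg.1 h1

/-- A nonnegative functional that prices eligible portfolios like `w` comes from a dual pair. -/
theorem exists_mem_coherentDualPairs (hT : ℱ T = mΩ)
    (hw : AEStronglyMeasurable[ℱ t] w P) (hwM : ∀ᵐ ω ∂P, w ω ∉ perp (eligibleSpace d k))
    {v : Ω → Fin d → ℝ} (hv : v ∈ lpDualCone p P q (acceptanceSet p P R))
    (hv0 : ∀ᵐ ω ∂P, 0 ≤ v ω)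
    (hvw : ∀ u ∈ eligible (ℱ t) p P (eligibleSpace d k),
      ∫ ω, v ω ⬝ᵥ u ω ∂P = ∫ ω, w ω ⬝ᵥ u ω ∂P) :
    ∃ x ∈ coherentDualPairs ℱ P (eligibleSpace d k) q t T R w,
      transport ℱ P t T x.1 ⇑(w + x.2) =ᵐ[P] v := by
  have hq : 1 ≤ q := ENNReal.HolderConjugate.one_le q p
  have hvi : ∀ i, Integrable (fun ω => v ω i) P := fun i => (hv.1.eval i).integrable hq
  obtain ⟨Q, hQ, hQv⟩ := exists_measureVectors_transport_condExp (t := t) hT hvi hv0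
  set b : Ω → Fin d → ℝ := fun ω i => (P[fun ω => v ω i | ℱ t]) ω with hb
  have hbL : MemLp b q P := memLp_pi_iff.2 fun i => (hv.1.eval i).condExp hq
  have hbm : StronglyMeasurable[ℱ t] b := by
    have : Measurable[ℱ t] b :=
      @measurable_pi_lambda _ _ _ (ℱ t) _ _ fun i => stronglyMeasurable_condExp.measurable
    exact this.stronglyMeasurable
  have hb0 : ∀ᵐ ω ∂P, 0 ≤ b ω := by
    have : ∀ i, ∀ᵐ ω ∂P, 0 ≤ b ω i := fun i => condExp_nonneg (by
      filter_upwards [hv0] with ω hω using hω i)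
    filter_upwards [ae_all_iff.2 this] with ω hω using hω
  have hbw : ∀ᵐ ω ∂P, ∀ i : Fin d, (i : ℕ) < k → b ω i = w ω i := by
    refine ae_all_iff.2 fun i => ?_
    by_cases hi : (i : ℕ) < k
    · filter_upwards [condExp_coord_ae_eq hw hv.1 hvw hi] with ω hω _ using hω
    · exact Filter.Eventually.of_forall fun ω h => absurd h hi
  -- The choice is `m_⊥ = E[v | ℱ_t] - w`; by `hbw` its first `k` coordinates vanish, which puts it
  -- in `M^⊥`.
  have hsum : w + (hbL.toLp b - w) = hbL.toLp b := add_sub_cancel _ _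
  have hcoe : ⇑(w + (hbL.toLp b - w)) =ᵐ[P] b := by
    rw [hsum]
    exact hbL.coeFn_toLp
  have htr : transport ℱ P t T Q ⇑(w + (hbL.toLp b - w)) =ᵐ[P] v := by
    refine Filter.EventuallyEq.trans ?_ hQv
    filter_upwards [hcoe] with ω hω
    funext i
    unfold transport
    rw [hω]
  have htrL : MemLp (transport ℱ P t T Q ⇑(w + (hbL.toLp b - w))) q P :=
    (memLp_congr_ae htr).2 hv.1
  refine ⟨(Q, hbL.toLp b - w), ⟨⟨hQ, ⟨?_, ?_⟩, hQ, ⟨?_, ?_⟩, htrL, ?_⟩, htrL, fun Z hZ => ?_⟩, htr⟩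
  · exact ((hbm.aestronglyMeasurable.congr hbL.coeFn_toLp.symm).sub hw).congr
      (Lp.coeFn_sub _ _).symm
  · filter_upwards [Lp.coeFn_sub (hbL.toLp b) w, hbL.coeFn_toLp, hbw] with ω h1 h2 h3 u hu
    rw [h1, Pi.sub_apply, h2, sub_dotProduct, dotProduct_eq_of_forall_lt h3 hu, sub_self]
  · exact hbm.aestronglyMeasurable.congr hcoe.symm
  · filter_upwards [hcoe, hb0, hbw, hwM] with ω h1 h2 h3 h4
    rw [h1]
    refine ⟨fun u hu => dotProduct_nonneg_of_nonneg h2 hu.2, fun hperp => h4 fun u hu => ?_⟩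
    rw [← dotProduct_eq_of_forall_lt h3 hu]
    exact hperp u hu
  · filter_upwards [htr, hv0] with ω h1 h2
    rw [h1]
    exact h2
  · refine (hv.2 Z hZ).trans_eq (integral_congr_ae ?_)
    filter_upwards [htr] with ω hω
    rw [hω]

/-- Supplies the eligible direction of positive price needed for the separation: the first `k`
coordinates of `w` are nonnegative, and zero price would force `w` into `M^⊥` almost surely. -/
theorem integral_dotProduct_eligibleOnes_pos {m : MeasurableSpace Ω}
    (hR : IsConditionalRiskMeasure m p P (eligibleSpace d k) R) (h0 : 0 ∈ R 0)
    {S : Ω → Set (Fin d → ℝ)} (hS : IsZeroSet m p P R S)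
    (hw : ∀ᵐ ω ∂P, w ω ∈ dualCone (S ω) \ perp (eligibleSpace d k)) :
    0 < ∫ ω, w ω ⬝ᵥ (Lp.const p P (eligibleOnes d k) : Lp (Fin d → ℝ) p P) ω ∂P := by
  have hwd := hw.mono fun _ h => h.1
  have hsingle : ∀ i : Fin d, (i : ℕ) < k →
      (Pi.single i 1 : Fin d → ℝ) ∈ posPart (eligibleSpace d k) := by
    refine fun i hi => ⟨fun j hj => Pi.single_eq_of_ne ?_ _, Pi.single_nonneg.2 zero_le_one⟩
    rintro rfl
    exact absurd hi (not_lt.2 hj)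
  have hcoord : ∀ i : Fin d, ∀ᵐ ω ∂P, (i : ℕ) < k → 0 ≤ w ω i := by
    intro i
    by_cases hi : (i : ℕ) < k
    · filter_upwards [dotProduct_nonneg_of_mem_dualCone hR h0 hS hwd
        (const_mem_eligiblePos (hsingle i hi)),
        Lp.coeFn_const (p := p) (μ := P) (Pi.single i 1 : Fin d → ℝ)] with ω h1 h2 _
      rw [h2] at h1
      simpa using h1
    · exact Filter.Eventually.of_forall fun ω h => absurd h hi
  have hnn := dotProduct_nonneg_of_mem_dualCone hR h0 hS hwd
    (const_mem_eligiblePos (eligibleOnes_mem (d := d) (k := k)))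
  refine lt_of_le_of_ne (integral_nonneg_of_ae hnn) fun heq => ?_
  rw [eq_comm, integral_eq_zero_iff_of_nonneg_ae hnn
    (integrable_dotProduct (Lp.memLp w) (Lp.memLp _))] at heq
  have hfalse : ∀ᵐ ω ∂P, False := by
    filter_upwards [heq, hw, ae_all_iff.2 hcoord,
      Lp.coeFn_const (p := p) (μ := P) (eligibleOnes d k)] with ω h1 h2 h3 h4
    rw [h4] at h1
    exact dotProduct_eligibleOnes_ne_zero h3 h2.2 h1
  obtain ⟨_, h⟩ := hfalse.exists
  exact h

/-- Strong duality in expectation. -/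
theorem exists_lt_integral_dualValue (htT : t ≤ T) (hT : ℱ T = mΩ)
    (hR : IsConditionalRiskMeasure (ℱ t) p P (eligibleSpace d k) R)
    (hcuc : IsConvexUpperContinuous (ℱ t) p P (eligibleSpace d k) R)
    (hcoh : IsCondCoherent (ℱ t) p P R) {S : Ω → Set (Fin d → ℝ)} (hS : IsZeroSet (ℱ t) p P R S)
    (hw : w ∈ LpIn (ℱ t) q P (fun ω => dualCone (S ω) \ perp (eligibleSpace d k)))
    {X : Lp (Fin d → ℝ) p P} (hX : (R X).Nonempty) {a : ℝ}
    (ha : ∀ u ∈ R X, a < ∫ ω, w ω ⬝ᵥ u ω ∂P) :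
    ∃ x ∈ coherentDualPairs ℱ P (eligibleSpace d k) q t T R w,
      Integrable (fun ω => (w + x.2) ω ⬝ᵥ condExpQ ℱ P t T x.1 (-X) ω) P ∧
      a < ∫ ω, (w + x.2) ω ⬝ᵥ condExpQ ℱ P t T x.1 (-X) ω ∂P := by
  have h0 := hR.zero_mem hcoh.2
  have hwd := hw.2.mono fun _ h => h.1
  have he := const_mem_eligiblePos (m := ℱ t) (p := p) (P := P) (eligibleOnes_mem (d := d) (k := k))
  obtain ⟨v, hvA, hv0, hvw, hva⟩ := exists_memLp_lt_neg_integral (ℱ.le t) hR hcuc hcoh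
    (Lp.memLp w)
    (fun u hu => integral_nonneg_of_ae (dotProduct_nonneg_of_mem_dualCone hR h0 hS hwd hu))
    (eligiblePos_subset_eligible _ he)
    (integral_dotProduct_eligibleOnes_pos hR h0 hS hw.2) hX ha
  obtain ⟨x, hx, hxv⟩ := exists_mem_coherentDualPairs hT hw.1 (hw.2.mono fun _ h => h.2)
    hvA hv0 hvw
  have h1 := dualValue_ae_eq_condExp htT hx X
  refine ⟨x, hx, integrable_condExp.congr h1.symm, ?_⟩
  rw [integral_congr_ae h1, integral_condExp (ℱ.le t), integral_neg]
  refine hva.trans_eq ?_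
  congr 1
  refine integral_congr_ae ?_
  filter_upwards [hxv] with ω hω
  rw [hω]

end Representation

end SetRisk

theorem corollary3p4
    {Ω : Type*} [mΩ : MeasurableSpace Ω] (P : Measure Ω) [IsProbabilityMeasure P]
    {ι : Type*} [LinearOrder ι] (ℱ : Filtration ι mΩ) (t T : ι) (htT : t ≤ T) (hT : ℱ T = mΩ)
    (p q : ℝ≥0∞) [Fact (1 ≤ p)] [ENNReal.HolderConjugate p q]
    (d m : ℕ) (hm : 1 ≤ m) (hmd : m ≤ d)
    (R : Lp (Fin d → ℝ) p P → Set (Lp (Fin d → ℝ) p P))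
    (hR : SetRisk.IsConditionalRiskMeasure (ℱ t) p P (SetRisk.eligibleSpace d m) R)
    (hnorm : SetRisk.IsNormalized p P R)
    (hcuc : SetRisk.IsConvexUpperContinuous (ℱ t) p P (SetRisk.eligibleSpace d m) R)
    (hcoh : SetRisk.IsCondCoherent (ℱ t) p P R)
    (S : Ω → Set (Fin d → ℝ)) (hS : SetRisk.IsZeroSet (ℱ t) p P R S)
    (hint : ∀ w ∈ SetRisk.LpIn (ℱ t) q P
        (fun ω => SetRisk.dualCone (S ω) \ SetRisk.perp (SetRisk.eligibleSpace d m)),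
      ∀ X : Lp (Fin d → ℝ) p P, ∃ Y : Ω → ℝ, Integrable Y P ∧
        SetRisk.scalarization R (ℱ.le t) w X =ᵐ[P] fun ω => (Y ω : EReal))
    (w : Lp (Fin d → ℝ) q P)
    (hw : w ∈ SetRisk.LpIn (ℱ t) q P
      (fun ω => SetRisk.dualCone (S ω) \ SetRisk.perp (SetRisk.eligibleSpace d m)))
    (X : Lp (Fin d → ℝ) p P) :
    SetRisk.scalarization R (ℱ.le t) w X =ᵐ[P]
      SetRisk.famEssSup (ℱ.le t) P
        (fun (x : SetRisk.coherentDualPairs ℱ P (SetRisk.eligibleSpace d m) q t T R w) ω =>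
          (((w + x.1.2) ω ⬝ᵥ SetRisk.condExpQ ℱ P t T x.1.1 (-X) ω : ℝ) : EReal)) := by
  obtain ⟨Y, hY, hρY⟩ := hint w hw X
  have hρ : SetRisk.IsFamEssInf (ℱ t) P
      (fun (u : R X) ω => ((w ω ⬝ᵥ (u : Lp (Fin d → ℝ) p P) ω : ℝ) : EReal))
      (SetRisk.scalarization R (ℱ.le t) w X) := SetRisk.isFamEssInf_famEssInf _ _ _
  -- The essential infimum of the empty family is `⊤`, which integrability of `ρ` excludes.
  have hX : (R X).Nonempty := by
    by_contra hempty
    have htop := hρ.greatest (fun _ => ⊤) measurable_const fun u => absurd ⟨u.1, u.2⟩ hempty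
    have hfalse : ∀ᵐ ω ∂P, False := by
      filter_upwards [htop, hρY] with ω h1 h2
      rw [h2] at h1
      exact EReal.coe_ne_top _ (top_le_iff.1 h1)
    obtain ⟨_, h⟩ := hfalse.exists
    exact h
  have hV := SetRisk.isFamEssSup_famEssSup (ℱ.le t) P
    (fun (x : SetRisk.coherentDualPairs ℱ P (SetRisk.eligibleSpace d m) q t T R w) ω =>
      (((w + x.1.2) ω ⬝ᵥ SetRisk.condExpQ ℱ P t T x.1.1 (-X) ω : ℝ) : EReal))
  refine hρY.trans (hV.ae_eq_of_integral (ℱ.le t) hY ?_ fun a ha => ?_).symm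
  · refine Filter.EventuallyLE.trans ?_ hρY.le
    refine hρ.greatest _ hV.measurable fun u => ?_
    -- Minimality of the essential supremum applies only to `ℱ_t`-measurable bounds, so `wᵀu` is
    -- replaced by such a version.
    obtain ⟨g, hg, hgu⟩ := SetRisk.aestronglyMeasurable_dotProduct hw.1
      (hR.subset_eligible X u.2).1
    refine (hV.least (fun ω => (g ω : EReal)) hg.measurable.coe_real_ereal fun x => ?_).trans ?_
    · filter_upwards [SetRisk.dualValue_le_dotProduct htT hR hcoh.2 x.2 u.2, hgu] with ω hω h2
      rw [← h2]
      exact EReal.coe_le_coe_iff.2 hω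
    · filter_upwards [hgu] with ω hω
      rw [hω]
  -- Only `ρ ≤ wᵀu` enters, so `E[ρ]` need not be identified with the infimum of the prices
  -- `E[wᵀu]`.
  · have hau : ∀ u ∈ R X, a < ∫ ω, w ω ⬝ᵥ u ω ∂P := fun u hu => by
      refine ha.trans_le (integral_mono_ae hY
        (SetRisk.integrable_dotProduct (Lp.memLp w) (Lp.memLp u)) ?_)
      filter_upwards [hρ.lower ⟨u, hu⟩, hρY] with ω h1 h2
      rw [h2] at h1
      exact EReal.coe_le_coe_iff.1 h1
    obtain ⟨x, hx, hxi, hax⟩ :=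
      SetRisk.exists_lt_integral_dualValue htT hT hR hcuc hcoh hS hw hX hau
    exact ⟨⟨x, hx⟩, hxi, hax⟩
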